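/- Let $k$ be an algebraically closed field of characteristic $p>0$, let $q=p^e$ with $e\ge 1$, and put $d=q+1$. An \emph{extremal surface} of degree $d$ is a surface $X\subset\mathbb P^3_k$ defined by a Frobenius form $\sum_{i=1}^4 x_i^{q}L_i$, where $L_1,\dots,L_4$ are linear forms. Let $X$ be a smooth extremal surface of degree $d$. \emph{Terminology.} A \emph{star} on $X$ with center $p$ is a set of $d$ lines on $X$ all passing through the point $p$; then $p$ is called a \emph{star point}, and a plane containing the star is called a \emph{star plane} centered at $p$. A \emph{star chord} of $X$ is a line not contained in $X$ that passes through at least two star points of $X$. The \emph{dual} of a star chord $\ell$ is the star chord $\ell'$ which is the intersection of all star planes centered at points of $\ell$; duality is symmetric. A \emph{quadric configuration} on $X$ is a set of $2d$ lines on $X$ that consists of two sets of $d$ mutually skew lines, such that each line of either set meets every line of the other. A quadric $Q$ \emph{defines} a quadric configuration on $X$ if $Q\cap X$ is the union of the lines of a quadric configuration on $X$ (such a quadric is smooth). A \emph{double $2d$} is a pair of sets $\mathcal A,\mathcal B$, each consisting of $2d$ mutually skew lines in $\mathbb P^3$, such that each line of either set intersects exactly $d+2$ lines of the other. \emph{Theorem.}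 Let $Q$ and $Q'$ be distinct quadrics that define quadric configurations on $X$. Assume that $Q$ and $Q'$ contain a common line, but that no line on $X$ is contained in both $Q$ and $Q'$. Then: (i) The lines contained in $Q\cap X$ or in $Q'\cap X$ are $4d$ in number, and they can be split into two disjoint sets of $2d$ lines forming a double $2d$. (ii) The intersection $Q\cap Q'$ is the union of four distinct star chords $\ell,m,\ell',m'$ of $X$, where $\ell,\ell'$ are dual to each other, $m,m'$ are dual to each other, and $\{\ell,\ell'\}$ and $\{m,m'\}$ lie in opposite rulings, both of $Q$ and of $Q'$. -/

import Mathlib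

namespace ExtremalSurface

variable {k : Type*} [Field k]

/-- The points of projective three-space over `k`. -/
abbrev Pt (k : Type*) [Field k] : Type _ := Projectivization k (Fin 4 → k)

/-- The lines of projective three-space: two-dimensional linear subspaces of `k ^ 4`. -/
abbrev PLine (k : Type*) [Field k] : Type _ :=
  {L : Submodule k (Fin 4 → k) // Module.finrank k L = 2}

/-- The set of points of projective three-space lying in a linear subspace of `k ^ 4`. -/
def subspacePoints (W : Submodule k (Fin 4 → k)) : Set (Pt k) :=
  {p | p.submodule ≤ W}

/-- The points of a line. -/
def PLine.points (L : PLine k) : Set (Pt k) := subspacePoints L.1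

/-- The lines `L` and `M` have a common point. -/
def Meets (L M : PLine k) : Prop := (L.points ∩ M.points).Nonempty

/-- The lines `L` and `M` are skew. -/
def Skew (L M : PLine k) : Prop := Disjoint L.points M.points

/-- The zero locus in projective three-space of a (homogeneous) polynomial. -/
def zeroLocus (F : MvPolynomial (Fin 4) k) : Set (Pt k) :=
  {p | ∀ v ∈ p.submodule, MvPolynomial.eval v F = 0}

/-- The lines contained in a subset of projective three-space. -/
def linesIn (Y : Set (Pt k)) : Set (PLine k) := {L | L.points ⊆ Y}

/-- A Frobenius form (in four variables) of degree `q + 1`: a polynomial `∑ xᵢ ^ q * Lᵢ` with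
`Lᵢ` linear forms.  It is meant for `q` a positive power of the characteristic. -/
def IsFrobeniusForm (q : ℕ) (F : MvPolynomial (Fin 4) k) : Prop :=
  ∃ l : Fin 4 → MvPolynomial (Fin 4) k,
    (∀ i, (l i).IsHomogeneous 1) ∧ F = ∑ i, MvPolynomial.X i ^ q * l i

/-- The projective surface `F = 0` is smooth (Jacobian criterion; `k` algebraically closed). -/
def IsSmoothSurface (F : MvPolynomial (Fin 4) k) : Prop :=
  ∀ v : Fin 4 → k, v ≠ 0 → MvPolynomial.eval v F = 0 →
    ∃ i, MvPolynomial.eval v (MvPolynomial.pderiv i F) ≠ 0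

/-- `G` is an equation of a quadric surface. -/
def IsQuadricForm (G : MvPolynomial (Fin 4) k) : Prop :=
  G ≠ 0 ∧ G.IsHomogeneous 2

/-! In what follows `X` is (the point set of) a surface of degree `d`. -/

/-- `S` is a star on `X` with center `p`: `d` lines on `X` through `p`. -/
def IsStar (X : Set (Pt k)) (d : ℕ) (S : Set (PLine k)) (p : Pt k) : Prop :=
  S.encard = d ∧ S ⊆ linesIn X ∧ ∀ L ∈ S, p ∈ L.points

/-- `p` is a star point of `X`. -/
def IsStarPoint (X : Set (Pt k)) (d : ℕ) (p : Pt k) : Prop :=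
  ∃ S, IsStar X d S p

/-- `H` (a three-dimensional subspace of `k ^ 4`) is a star plane of `X` with center `p`: a plane
that contains a star with center `p`. -/
def IsStarPlane (X : Set (Pt k)) (d : ℕ) (H : Submodule k (Fin 4 → k)) (p : Pt k) : Prop :=
  Module.finrank k H = 3 ∧ ∃ S, IsStar X d S p ∧ ∀ L ∈ S, L.1 ≤ H

/-- A star chord of `X`: a line not on `X` through at least two star points of `X`. -/
def IsStarChord (X : Set (Pt k)) (d : ℕ) (l : PLine k) : Prop :=
  ¬ l.points ⊆ X ∧ ∃ p₁ ∈ l.points, ∃ p₂ ∈ l.points,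
    p₁ ≠ p₂ ∧ IsStarPoint X d p₁ ∧ IsStarPoint X d p₂

/-- `l'` is the dual of the star chord `l`: it is a star chord, and it is the intersection of all
star planes whose center lies on `l`. -/
def IsDualChord (X : Set (Pt k)) (d : ℕ) (l l' : PLine k) : Prop :=
  IsStarChord X d l ∧ IsStarChord X d l' ∧
    l'.1 = sInf {H | ∃ p ∈ l.points, IsStarPlane X d H p}

/-- `l` and `l'` are a pair of dual star chords, each one the dual of the other. -/
def IsDualPair (X : Set (Pt k)) (d : ℕ) (l l' : PLine k) : Prop :=
  IsDualChord X d l l' ∧ IsDualChord X d l' l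

/-- `C` is a quadric configuration on `X`: `2 * d` lines on `X`, consisting of two sets of `d`
mutually skew lines such that each line of either set meets every line of the other. -/
def IsQuadricConfiguration (X : Set (Pt k)) (d : ℕ) (C : Set (PLine k)) : Prop :=
  C ⊆ linesIn X ∧ C.encard = 2 * d ∧
    ∃ A B : Set (PLine k), C = A ∪ B ∧ A.encard = d ∧ B.encard = d ∧
      A.Pairwise Skew ∧ B.Pairwise Skew ∧ ∀ L ∈ A, ∀ M ∈ B, Meets L M

/-- The quadric `Q` defines a quadric configuration on `X`: the intersection of `Q` and `X` is
the union of the lines of a quadric configuration on `X`. -/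
def DefinesQuadricConfiguration (X : Set (Pt k)) (d : ℕ) (Q : Set (Pt k)) : Prop :=
  ∃ C, IsQuadricConfiguration X d C ∧ Q ∩ X = ⋃ L ∈ C, L.points

/-- `A` and `B` form a double `2d`: each consists of `2 * d` mutually skew lines, and each line of
either one intersects exactly `d + 2` lines of the other. -/
def IsDouble2d (d : ℕ) (A B : Set (PLine k)) : Prop :=
  A.encard = 2 * d ∧ B.encard = 2 * d ∧ A.Pairwise Skew ∧ B.Pairwise Skew ∧
    (∀ L ∈ A, {M ∈ B | Meets L M}.encard = d + 2) ∧
    (∀ L ∈ B, {M ∈ A | Meets L M}.encard = d + 2)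

/-- `R` is a ruling of the quadric `Q`: a family of mutually skew lines on `Q` that covers `Q`. -/
def IsRuling (Q : Set (Pt k)) (R : Set (PLine k)) : Prop :=
  R ⊆ linesIn Q ∧ R.Pairwise Skew ∧ ∀ p ∈ Q, ∃ L ∈ R, p ∈ L.points

/-- The sets of lines `S` and `T` on the quadric `Q` lie in opposite rulings of `Q`. -/
def InOppositeRulings (Q : Set (Pt k)) (S T : Set (PLine k)) : Prop :=
  ∃ R R' : Set (PLine k), IsRuling Q R ∧ IsRuling Q R' ∧ R ≠ R' ∧ S ⊆ R ∧ T ⊆ R'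

end ExtremalSurface

namespace ExtremalSurface

variable {k : Type*} [Field k]

/-! ### Points and lines -/

-- A Frobenius form is `β v v` for a form `β` that is linear in its second argument and
-- Frobenius-semilinear in its first. Since `x ^ q` has zero derivative, the gradient of `F` at `v`
-- is the functional `β v`. Smoothness of `X` thus gives nondegeneracy of `β`, and the tangent plane
-- at `p` is `ker (β p)`. The same `formLocus`, with identity twist, describes the quadrics.
--
-- Because the twist is not the identity, `β` vanishes on all pairs from a line on `X`, so lines on
-- `X` through `p` lie in the tangent plane at `p`. If two lines on `X` meet at `p`, they span this
-- plane, and left and right orthogonality to `p` agree on it (`IsHermitianPoint`).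
--
-- Let `L` be a line common to `Q` and `Q'`. A point of `L ∩ X` lies on a configuration line of each
-- quadric, in the ruling opposite to `L`; these two differ because no line of `X` is common. Hence
-- every such point is Hermitian, and there are at least `d` of them. The orthogonal line `L'` is
-- coplanar with each configuration line `M` meeting `L`, so it meets `Q` in three points and lies
-- on `Q`, in the ruling of `L` (`perp_mem`); likewise for `Q'`. Joining a point of `L ∩ X` to `d`
-- points of `L' ∩ X` produces stars, which makes `L, L'` dual star chords.
--
-- A point of `Q ∩ Q'` off `L` and `L'` gives a line of the opposite ruling that meets `Q'` three
-- times, so a second common pair `m, m'` appears. Any further point of `Q ∩ Q'` would force `Q ⊆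
-- Q'`, so the intersection is these four lines. Write the configurations as `A ∪ B` and `A' ∪ B'`,
-- matched so that `L` belongs to the rulings of `A` and `A'`. A common point of a line of the first
-- with a line of the second lies on one of the four chords, which decides all incidences; the
-- double `2d` is `A ∪ B'`, `B ∪ A'`.

theorem PLine.mem_points {L : PLine k} {p : Pt k} : p ∈ L.points ↔ p.rep ∈ L.1 := by
  simp [PLine.points, subspacePoints, Projectivization.submodule_eq]

theorem PLine.mk_mem_points {L : PLine k} {v : Fin 4 → k} (hv : v ≠ 0) :
    Projectivization.mk k v hv ∈ L.points ↔ v ∈ L.1 := by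
  simp [PLine.points, subspacePoints, Projectivization.submodule_mk]

theorem skew_iff_not_meets {L M : PLine k} : Skew L M ↔ ¬ Meets L M := by
  rw [Skew, Meets, Set.not_nonempty_iff_eq_empty, Set.disjoint_iff_inter_eq_empty]

theorem Meets.symm {L M : PLine k} (h : Meets L M) : Meets M L := by
  rwa [Meets, Set.inter_comm]

theorem Skew.symm {L M : PLine k} (h : Skew L M) : Skew M L := Disjoint.symm h

theorem linearIndependent_rep {p q : Pt k} (hpq : p ≠ q) :
    LinearIndependent k ![p.rep, q.rep] := by
  have h := (Projectivization.independent_iff).1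
    ((Projectivization.independent_pair_iff_ne p q).2 hpq)
  have e : ![p.rep, q.rep] = Projectivization.rep ∘ ![p, q] := by
    funext i
    fin_cases i <;> rfl
  rwa [e]

theorem rep_pair_eq_zero {p q : Pt k} (hpq : p ≠ q) {a b : k} (h : a • p.rep + b • q.rep = 0) :
    a = 0 ∧ b = 0 := by
  have hli := linearIndependent_rep hpq
  rw [LinearIndependent.pair_iff] at hli
  exact hli a b h

theorem finrank_span_rep {p q : Pt k} (hpq : p ≠ q) :
    Module.finrank k (Submodule.span k {p.rep, q.rep}) = 2 := by
  have h := finrank_span_eq_card (linearIndependent_rep hpq)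
  rwa [Matrix.range_cons_cons_empty, Fintype.card_fin] at h

theorem PLine.eq_span {L : PLine k} {p q : Pt k} (hpq : p ≠ q) (hp : p ∈ L.points)
    (hq : q ∈ L.points) : L.1 = Submodule.span k {p.rep, q.rep} := by
  symm
  apply Submodule.eq_of_le_of_finrank_eq
  · rw [Submodule.span_le]
    rintro x (rfl | rfl)
    · exact PLine.mem_points.1 hp
    · exact PLine.mem_points.1 hq
  · rw [finrank_span_rep hpq, L.2]

theorem PLine.eq_of_mem {L M : PLine k} {p q : Pt k} (hpq : p ≠ q) (hp : p ∈ L.points)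
    (hq : q ∈ L.points) (hp' : p ∈ M.points) (hq' : q ∈ M.points) : L = M :=
  Subtype.ext ((PLine.eq_span hpq hp hq).trans (PLine.eq_span hpq hp' hq').symm)

theorem exists_line_through {p q : Pt k} (hpq : p ≠ q) :
    ∃ L : PLine k, p ∈ L.points ∧ q ∈ L.points := by
  refine ⟨⟨Submodule.span k {p.rep, q.rep}, finrank_span_rep hpq⟩, ?_, ?_⟩ <;>
  · rw [PLine.mem_points]
    exact Submodule.subset_span (by simp)

theorem PLine.infinite_points [Infinite k] (L : PLine k) : L.points.Infinite := by
  obtain ⟨⟨⟨x, hx⟩, ⟨y, hy⟩⟩, h⟩ : ∃ z : L.1 × L.1,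
      LinearIndependent k ![(z.1 : Fin 4 → k), z.2] := by
    let b := Module.finBasisOfFinrankEq k L.1 L.2
    refine ⟨(b 0, b 1), ?_⟩
    have h := b.linearIndependent.map' L.1.subtype (by simp)
    have e : ![(b 0 : Fin 4 → k), (b 1 : Fin 4 → k)] = L.1.subtype ∘ b := by
      funext i
      fin_cases i <;> rfl
    rwa [e]
  simp only at h
  rw [LinearIndependent.pair_iff] at h
  have hne : ∀ c : k, x + c • y ≠ 0 := fun c hc => by
    have := (h 1 c (by simpa using hc)).1
    exact one_ne_zero this
  refine Set.infinite_of_injective_forall_mem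
    (f := fun c : k => Projectivization.mk k (x + c • y) (hne c)) ?_ ?_
  · intro c d hcd
    obtain ⟨a, ha⟩ := (Projectivization.mk_eq_mk_iff' k _ _ _ _).1 hcd
    have := h (a - 1) (a * d - c) (by
      rw [smul_add, smul_smul] at ha
      rw [sub_smul, sub_smul, one_smul]
      linear_combination (exp := 1) ha)
    have ha1 : a = 1 := by linear_combination this.1
    have := this.2
    rw [ha1] at this
    linear_combination -this
  · intro c
    rw [PLine.mk_mem_points]
    exact L.1.add_mem hx (L.1.smul_mem c hy)

/-- Distinct lines share at most one point, whereas a line over an infinite field has infinitely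
many. -/
theorem PLine.mem_of_subset_iUnion [Infinite k] {L : PLine k} {C : Set (PLine k)} (hC : C.Finite)
    (h : L.points ⊆ ⋃ M ∈ C, M.points) : L ∈ C := by
  by_contra hL
  refine L.infinite_points ?_
  have h' : L.points ⊆ ⋃ M ∈ C, L.points ∩ M.points := fun p hp => by
    obtain ⟨M, hM, hpM⟩ := Set.mem_iUnion₂.1 (h hp)
    exact Set.mem_iUnion₂.2 ⟨M, hM, hp, hpM⟩
  refine (hC.biUnion fun M hM => Set.Subsingleton.finite ?_).subset h'
  intro p hp q hq
  by_contra hpq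
  exact hL (PLine.eq_of_mem hpq hp.1 hq.1 hp.2 hq.2 ▸ hM)

theorem finrank_sup_of_ne {L M : PLine k} (h : L ≠ M) : 3 ≤ Module.finrank k ↥(L.1 ⊔ M.1) := by
  by_contra! hlt
  have h1 : L.1 = L.1 ⊔ M.1 := Submodule.eq_of_le_of_finrank_le le_sup_left (by rw [L.2]; omega)
  have h2 : M.1 = L.1 ⊔ M.1 := Submodule.eq_of_le_of_finrank_le le_sup_right (by rw [M.2]; omega)
  exact h (Subtype.ext (h1.trans h2.symm))

theorem meets_of_le {L M : PLine k} {H : Submodule k (Fin 4 → k)} (hH : Module.finrank k H = 3)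
    (hL : L.1 ≤ H) (hM : M.1 ≤ H) : Meets L M := by
  have h1 := Submodule.finrank_sup_add_finrank_inf_eq L.1 M.1
  have h2 := Submodule.finrank_mono (sup_le hL hM)
  rw [L.2, M.2] at h1
  have h3 : L.1 ⊓ M.1 ≠ ⊥ := by
    intro h
    rw [h, finrank_bot] at h1
    omega
  obtain ⟨v, hv, hv0⟩ := Submodule.exists_mem_ne_zero_of_ne_bot h3
  exact ⟨Projectivization.mk k v hv0, (PLine.mk_mem_points hv0).2 hv.1,
    (PLine.mk_mem_points hv0).2 hv.2⟩

/-! ### Sesquilinear forms -/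

section Sesquilinear

variable {σ : k →+* k} (β : (Fin 4 → k) →ₛₗ[σ] (Fin 4 → k) →ₗ[k] k)

/-- The points that are isotropic for the sesquilinear form `β`. -/
def formLocus : Set (Pt k) := {p | ∀ v ∈ p.submodule, β v v = 0}

/-- The points whose left-orthogonal plane is right-orthogonal to them. -/
def IsHermitianPoint (p : Pt k) : Prop := ∀ y, β p.rep y = 0 → β y p.rep = 0

/-- The right-orthogonal complement of a subspace. -/
def perp (W : Submodule k (Fin 4 → k)) : Submodule k (Fin 4 → k) where
  carrier := {v | ∀ u ∈ W, β u v = 0}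
  add_mem' ha hb u hu := by rw [map_add, ha u hu, hb u hu, add_zero]
  zero_mem' u _ := map_zero _
  smul_mem' c v hv u hu := by rw [map_smul, hv u hu, smul_zero]

variable {β}

theorem mem_perp {W : Submodule k (Fin 4 → k)} {v : Fin 4 → k} :
    v ∈ perp β W ↔ ∀ u ∈ W, β u v = 0 := Iff.rfl

theorem mem_formLocus {p : Pt k} : p ∈ formLocus β ↔ β p.rep p.rep = 0 := by
  constructor
  · intro h
    exact h _ (by rw [Projectivization.submodule_eq]; exact Submodule.mem_span_singleton_self _)
  · intro h v hv
    rw [Projectivization.submodule_eq, Submodule.mem_span_singleton] at hv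
    obtain ⟨a, rfl⟩ := hv
    simp [LinearMap.map_smulₛₗ, h]

theorem subset_formLocus {L : PLine k} (h : ∀ u ∈ L.1, β u u = 0) : L.points ⊆ formLocus β :=
  fun _ hp => mem_formLocus.2 (h _ (PLine.mem_points.1 hp))

theorem apply_self_eq_zero {L : PLine k} (h : L.points ⊆ formLocus β) {u : Fin 4 → k}
    (hu : u ∈ L.1) : β u u = 0 := by
  by_cases h0 : u = 0
  · simp [h0]
  · have := h ((PLine.mk_mem_points h0).2 hu)
    exact this u (by rw [Projectivization.submodule_mk]; exact Submodule.mem_span_singleton_self _)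

/-- Isotropy of `u + v` and of `u + b • v` gives two linear equations in `β u v` and `β v u` with
determinant `σ b - b` up to sign. This fails for bilinear forms, where only the symmetrized value
vanishes. -/
theorem apply_eq_zero_of_subset (hσ : ∃ b, σ b ≠ b) {L : PLine k} (h : L.points ⊆ formLocus β)
    {u v : Fin 4 → k} (hu : u ∈ L.1) (hv : v ∈ L.1) : β u v = 0 := by
  obtain ⟨b, hb⟩ := hσ
  have h1 := apply_self_eq_zero h (L.1.add_mem hu hv)
  have h2 := apply_self_eq_zero h (L.1.add_mem hu (L.1.smul_mem b hv))
  have h3 := apply_self_eq_zero h hu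
  have h4 := apply_self_eq_zero h hv
  simp only [map_add, LinearMap.add_apply, LinearMap.map_smulₛₗ, LinearMap.smul_apply, h3, h4,
    smul_eq_mul, RingHom.id_apply] at h1 h2
  have h5 : (σ b - b) * β u v = 0 := by linear_combination σ b * h1 - h2
  exact (mul_eq_zero.1 h5).resolve_left (sub_ne_zero.2 hb)

theorem PLine.le_ker (hσ : ∃ b, σ b ≠ b) {L : PLine k} (h : L.points ⊆ formLocus β) {p : Pt k}
    (hp : p ∈ L.points) : L.1 ≤ LinearMap.ker (β p.rep) := fun _ hv =>
  LinearMap.mem_ker.2 (apply_eq_zero_of_subset hσ h (PLine.mem_points.1 hp) hv)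

section Nondegenerate

variable (hβ : ∀ v, β v = 0 → v = 0)
include hβ

theorem finrank_ker_rep (p : Pt k) : Module.finrank k (LinearMap.ker (β p.rep)) = 3 := by
  have h1 := Module.Dual.finrank_ker_add_one_of_ne_zero (f := β p.rep)
    fun h => p.rep_nonzero (hβ _ h)
  rw [Module.finrank_fin_fun] at h1
  omega

theorem sup_eq_ker (hσ : ∃ b, σ b ≠ b) {L M : PLine k} (hL : L.points ⊆ formLocus β)
    (hM : M.points ⊆ formLocus β) (hLM : L ≠ M) {p : Pt k} (hpL : p ∈ L.points)
    (hpM : p ∈ M.points) : L.1 ⊔ M.1 = LinearMap.ker (β p.rep) :=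
  Submodule.eq_of_le_of_finrank_le
    (sup_le (PLine.le_ker hσ hL hpL) (PLine.le_ker hσ hM hpM))
    ((finrank_ker_rep hβ p).trans_le (finrank_sup_of_ne hLM))

theorem isHermitianPoint_of_two_lines (hσ : ∃ b, σ b ≠ b) {L M : PLine k}
    (hL : L.points ⊆ formLocus β) (hM : M.points ⊆ formLocus β) (hLM : L ≠ M) {p : Pt k}
    (hpL : p ∈ L.points) (hpM : p ∈ M.points) : IsHermitianPoint β p := by
  intro y hy
  rw [← LinearMap.mem_ker, ← sup_eq_ker hβ hσ hL hM hLM hpL hpM, Submodule.mem_sup] at hy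
  obtain ⟨a, ha, b, hb, rfl⟩ := hy
  rw [map_add, LinearMap.add_apply,
    apply_eq_zero_of_subset hσ hL ha (PLine.mem_points.1 hpL),
    apply_eq_zero_of_subset hσ hM hb (PLine.mem_points.1 hpM), add_zero]

theorem finrank_perp (hσ : Function.Surjective σ) (L : PLine k) :
    Module.finrank k (perp β L.1) = 2 := by
  let b := Module.finBasisOfFinrankEq k L.1 L.2
  have hb : LinearIndependent k fun i => (b i : Fin 4 → k) :=
    b.linearIndependent.map' L.1.subtype (by simp)
  have hli : LinearIndependent k fun i => β (b i) := by
    rw [Fintype.linearIndependent_iff] at hb ⊢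
    intro g hg
    -- Semilinearity turns a relation among the `β (b i)` into one among the `b i` only after the
    -- coefficients are pulled back along `σ`; this is where surjectivity enters.
    choose g' hg' using fun i => hσ (g i)
    have h1 : β (∑ i, g' i • (b i : Fin 4 → k)) = 0 := by
      rw [map_sum, ← hg]
      simp [LinearMap.map_smulₛₗ, hg']
    intro i
    rw [← hg' i, hb g' (hβ _ h1) i, map_zero]
  have hspan : L.1 = Submodule.span k (Set.range fun i => (b i : Fin 4 → k)) := by
    have := congrArg (Submodule.map L.1.subtype) b.span_eq
    rw [Submodule.map_span, ← Set.range_comp, Submodule.map_top, Submodule.range_subtype] at this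
    exact this.symm
  have hperp : perp β L.1 = (Submodule.span k (Set.range fun i => β (b i))).dualCoannihilator := by
    ext v
    rw [mem_perp, Submodule.mem_dualCoannihilator]
    constructor
    · intro h φ hφ
      induction hφ using Submodule.span_induction with
      | mem x hx => obtain ⟨i, rfl⟩ := hx; exact h _ (b i).2
      | zero => simp
      | add x y _ _ hx hy => simp [hx, hy]
      | smul a x _ hx => simp [hx]
    · intro h u hu
      rw [hspan] at hu
      induction hu using Submodule.span_induction with
      | mem x hx => obtain ⟨i, rfl⟩ := hx; exact h _ (Submodule.subset_span ⟨i, rfl⟩)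
      | zero => simp
      | add x y _ _ hx hy => simp [hx, hy]
      | smul a x _ hx => simp [LinearMap.map_smulₛₗ, hx]
  have h2 := Subspace.finrank_add_finrank_dualCoannihilator_eq
    (Submodule.span k (Set.range fun i => β (b i)))
  rw [finrank_span_eq_card hli, ← hperp, Fintype.card_fin, Module.finrank_fin_fun] at h2
  omega

end Nondegenerate

-- Stars, Hermitian chords and dual pairs of star chords.

theorem exists_isStar {L L' : PLine k} (hL' : L'.1 = perp β L.1) {p : Pt k} (hpL : p ∈ L.points)
    (hpX : p ∈ formLocus β) (hp : IsHermitianPoint β p) (hpL' : p ∉ L'.points) {P : Set (Pt k)}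
    {d : ℕ} (hP : P ⊆ L'.points ∩ formLocus β) (hcard : P.encard = d) :
    ∃ S, IsStar (formLocus β) d S p ∧ ∀ N ∈ S, N.1 ≤ LinearMap.ker (β p.rep) := by
  -- The star consists of the joins of `p` to the points of `P`. Each join is on `X`: `β p q = 0` by
  -- orthogonality, and `β q p = 0` since `p` is Hermitian.
  have : Nonempty (PLine k) := ⟨L⟩
  have hne : ∀ q ∈ P, p ≠ q := fun q hq h => hpL' (h ▸ (hP hq).1)
  choose! f hf using fun q (hq : q ∈ P) => exists_line_through (hne q hq)
  have hspan : ∀ q ∈ P, ∀ v ∈ (f q).1, ∃ a b : k, v = a • p.rep + b • q.rep := by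
    intro q hq v hv
    rw [PLine.eq_span (hne q hq) (hf q hq).1 (hf q hq).2, Submodule.mem_span_pair] at hv
    obtain ⟨a, b, h⟩ := hv
    exact ⟨a, b, h.symm⟩
  have hpp := mem_formLocus.1 hpX
  have hpq : ∀ q ∈ P, β p.rep q.rep = 0 := by
    intro q hq
    have := PLine.mem_points.1 (hP hq).1
    rw [hL'] at this
    exact this _ (PLine.mem_points.1 hpL)
  refine ⟨f '' P, ⟨?_, ?_, ?_⟩, ?_⟩
  · rw [Set.InjOn.encard_image, hcard]
    intro q hq q' hq' h
    by_contra hqq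
    have h1 : f q = L' :=
      PLine.eq_of_mem hqq (hf q hq).2 (h ▸ (hf q' hq').2) (hP hq).1 (hP hq').1
    exact hpL' (h1 ▸ (hf q hq).1)
  · rintro _ ⟨q, hq, rfl⟩
    refine subset_formLocus fun v hv => ?_
    obtain ⟨a, b, rfl⟩ := hspan q hq v hv
    simp [LinearMap.map_smulₛₗ, hpp, hpq q hq, hp _ (hpq q hq), mem_formLocus.1 (hP hq).2]
  · rintro _ ⟨q, hq, rfl⟩
    exact (hf q hq).1
  · rintro _ ⟨q, hq, rfl⟩ v hv
    obtain ⟨a, b, rfl⟩ := hspan q hq v hv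
    simp [hpp, hpq q hq]

/-- A line not on the locus of `β` that contains `d` points of it, and for which all such points
are Hermitian. -/
structure IsHermitianChord (β : (Fin 4 → k) →ₛₗ[σ] (Fin 4 → k) →ₗ[k] k) (d : ℕ)
    (L : PLine k) : Prop where
  not_subset : ¬ L.points ⊆ formLocus β
  exists_points : ∃ P ⊆ L.points ∩ formLocus β, P.encard = d
  hermitian : ∀ p ∈ L.points, p ∈ formLocus β → IsHermitianPoint β p

namespace IsHermitianChord

variable {d : ℕ} {L L' : PLine k}

theorem exists_pair (h : IsHermitianChord β d L) (hd : 2 ≤ d) :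
    ∃ x ∈ L.points ∩ formLocus β, ∃ y ∈ L.points ∩ formLocus β, x ≠ y := by
  obtain ⟨P, hP, hc⟩ := h.exists_points
  have : 1 < P.encard := by
    rw [hc]
    exact_mod_cast hd
  obtain ⟨x, y, hx, hy, hxy⟩ := Set.one_lt_encard_iff.1 this
  exact ⟨x, hP hx, y, hP hy, hxy⟩

theorem exists_rep (hd : 2 ≤ d) (h : IsHermitianChord β d L) :
    ∃ x ∈ L.points ∩ formLocus β, ∃ y ∈ L.points ∩ formLocus β, x ≠ y ∧
      (∀ v ∈ L.1, ∃ a b : k, v = a • x.rep + b • y.rep) ∧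
      β x.rep y.rep ≠ 0 ∧ β y.rep x.rep ≠ 0 := by
  obtain ⟨x, hx, y, hy, hxy⟩ := h.exists_pair hd
  have hs : ∀ v ∈ L.1, ∃ a b : k, v = a • x.rep + b • y.rep := by
    intro v hv
    rw [PLine.eq_span hxy hx.1 hy.1, Submodule.mem_span_pair] at hv
    obtain ⟨a, b, h⟩ := hv
    exact ⟨a, b, h.symm⟩
  -- The Gram matrix of `β` on `x, y` has zero diagonal. If one off-diagonal entry vanished,
  -- Hermitianness would kill the other, and `L` would lie on the locus.
  have key : ¬ (β x.rep y.rep = 0 ∧ β y.rep x.rep = 0) := by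
    rintro ⟨h1, h2⟩
    refine h.not_subset (subset_formLocus fun v hv => ?_)
    obtain ⟨a, b, rfl⟩ := hs v hv
    simp [LinearMap.map_smulₛₗ, h1, h2, mem_formLocus.1 hx.2, mem_formLocus.1 hy.2]
  exact ⟨x, hx, y, hy, hxy, hs, fun h0 => key ⟨h0, h.hermitian x hx.1 hx.2 _ h0⟩,
    fun h0 => key ⟨h.hermitian y hy.1 hy.2 _ h0, h0⟩⟩

theorem skew_perp (h : IsHermitianChord β d L) (hd : 2 ≤ d) (hL' : L'.1 = perp β L.1) :
    Skew L L' := by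
  rw [skew_iff_not_meets]
  rintro ⟨p, hp, hp'⟩
  obtain ⟨x, hx, y, hy, -, hs, h1, h2⟩ := h.exists_rep hd
  rw [PLine.mem_points] at hp hp'
  rw [hL'] at hp'
  obtain ⟨a, b, hab⟩ := hs _ hp
  have h3 := hp' _ (PLine.mem_points.1 hx.1)
  have h4 := hp' _ (PLine.mem_points.1 hy.1)
  rw [hab] at h3 h4
  simp [mem_formLocus.1 hx.2, mem_formLocus.1 hy.2, h1, h2] at h3 h4
  exact p.rep_nonzero (by simp [hab, h3, h4])

/-- Orthogonality is not symmetric in general, but `L` is spanned by Hermitian points, at which it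
can be reversed. Equality then follows by dimension. -/
theorem perp_perp (hβ : ∀ v, β v = 0 → v = 0) (hσ : Function.Surjective σ)
    (h : IsHermitianChord β d L) (hd : 2 ≤ d) (hL' : L'.1 = perp β L.1) :
    L.1 = perp β L'.1 := by
  apply Submodule.eq_of_le_of_finrank_eq
  · intro v hv u hu
    obtain ⟨x, hx, y, hy, -, hs, -⟩ := h.exists_rep hd
    obtain ⟨a, b, rfl⟩ := hs v hv
    rw [hL'] at hu
    have h1 := h.hermitian x hx.1 hx.2 _ (hu _ (PLine.mem_points.1 hx.1))
    have h2 := h.hermitian y hy.1 hy.2 _ (hu _ (PLine.mem_points.1 hy.1))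
    simp [h1, h2]
  · rw [finrank_perp hβ hσ, L.2]

theorem exists_isStar (h : IsHermitianChord β d L) (h' : IsHermitianChord β d L') (hd : 2 ≤ d)
    (hL' : L'.1 = perp β L.1) {p : Pt k} (hp : p ∈ L.points ∩ formLocus β) :
    ∃ S, IsStar (formLocus β) d S p ∧ ∀ N ∈ S, N.1 ≤ LinearMap.ker (β p.rep) := by
  obtain ⟨P, hP, hc⟩ := h'.exists_points
  exact ExtremalSurface.exists_isStar hL' hp.1 hp.2 (h.hermitian p hp.1 hp.2)
    (fun hpL' => Set.disjoint_left.1 (h.skew_perp hd hL') hp.1 hpL') hP hc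

theorem isStarChord (h : IsHermitianChord β d L) (h' : IsHermitianChord β d L') (hd : 2 ≤ d)
    (hL' : L'.1 = perp β L.1) : IsStarChord (formLocus β) d L := by
  obtain ⟨x, hx, y, hy, hxy⟩ := h.exists_pair hd
  obtain ⟨S, hS, -⟩ := h.exists_isStar h' hd hL' hx
  obtain ⟨T, hT, -⟩ := h.exists_isStar h' hd hL' hy
  exact ⟨h.not_subset, x, hx.1, y, hy.1, hxy, ⟨S, hS⟩, ⟨T, hT⟩⟩

theorem isDualChord (hβ : ∀ v, β v = 0 → v = 0) (hσ : Function.Surjective σ)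
    (hσ' : ∃ b, σ b ≠ b) (h : IsHermitianChord β d L) (h' : IsHermitianChord β d L')
    (hd : 2 ≤ d) (hL' : L'.1 = perp β L.1) : IsDualChord (formLocus β) d L L' := by
  refine ⟨h.isStarChord h' hd hL', h'.isStarChord h hd (h.perp_perp hβ hσ hd hL'), ?_⟩
  apply le_antisymm
  · refine le_sInf ?_
    rintro H ⟨p, hp, hH, S, ⟨hc, hSX, hpS⟩, hSH⟩
    have h1 : 1 < S.encard := by
      rw [hc]
      exact_mod_cast hd
    obtain ⟨M, N, hM, hN, hMN⟩ := Set.one_lt_encard_iff.1 h1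
    -- Two lines of the star already span the tangent plane, so a star plane centered at `p` can
    -- only be `ker (β p)`.
    have h2 := sup_eq_ker hβ hσ' (hSX hM) (hSX hN) hMN (hpS M hM) (hpS N hN)
    have h3 : LinearMap.ker (β p.rep) = H := by
      rw [← h2]
      exact Submodule.eq_of_le_of_finrank_le (sup_le (hSH M hM) (hSH N hN))
        (hH.trans_le (finrank_sup_of_ne hMN))
    rw [← h3, hL']
    exact fun v hv => hv _ (PLine.mem_points.1 hp)
  · rw [hL']
    obtain ⟨x, hx, y, hy, -, hs, -⟩ := h.exists_rep hd
    intro v hv u hu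
    have key : ∀ z ∈ L.points ∩ formLocus β, β z.rep v = 0 := by
      intro z hz
      obtain ⟨S, hS, hSz⟩ := h.exists_isStar h' hd hL' hz
      exact (Submodule.mem_sInf.1 hv) _ ⟨z, hz.1, finrank_ker_rep hβ z, S, hS, hSz⟩
    obtain ⟨a, b, rfl⟩ := hs u hu
    simp [LinearMap.map_smulₛₗ, key x hx, key y hy]

theorem isDualPair (hβ : ∀ v, β v = 0 → v = 0) (hσ : Function.Surjective σ)
    (hσ' : ∃ b, σ b ≠ b) (h : IsHermitianChord β d L) (h' : IsHermitianChord β d L')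
    (hd : 2 ≤ d) (hL' : L'.1 = perp β L.1) : IsDualPair (formLocus β) d L L' :=
  ⟨h.isDualChord hβ hσ hσ' h' hd hL',
    h'.isDualChord hβ hσ hσ' h hd (h.perp_perp hβ hσ hd hL')⟩

end IsHermitianChord

end Sesquilinear

/-! ### Quadrics -/

theorem exists_linear_of_isHomogeneous_one {l : MvPolynomial (Fin 4) k} (hl : l.IsHomogeneous 1) :
    ∃ φ : (Fin 4 → k) →ₗ[k] k, (∀ v, MvPolynomial.eval v l = φ v) ∧
      ∀ i v, MvPolynomial.eval v (MvPolynomial.pderiv i l) = φ (Pi.single i 1) := by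
  rw [← MvPolynomial.mem_homogeneousSubmodule,
    MvPolynomial.homogeneousSubmodule_one_eq_span_X] at hl
  induction hl using Submodule.span_induction with
  | mem x hx =>
    obtain ⟨j, rfl⟩ := hx
    refine ⟨LinearMap.proj j, fun v => by simp, fun i v => ?_⟩
    simp only [MvPolynomial.pderiv_X, LinearMap.proj_apply, Pi.single_apply]
    split_ifs <;> simp_all
  | zero => exact ⟨0, fun v => by simp, fun i v => by simp⟩
  | add x y _ _ hx hy =>
    obtain ⟨f, hf, hf'⟩ := hx
    obtain ⟨g, hg, hg'⟩ := hy
    exact ⟨f + g, fun v => by simp [hf, hg], fun i v => by simp [hf', hg']⟩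
  | smul a x _ hx =>
    obtain ⟨f, hf, hf'⟩ := hx
    exact ⟨a • f, fun v => by simp [hf], fun i v => by simp [hf']⟩

/-- `B` is not required to be symmetric, so there is no division by 2 and characteristic 2 is
covered. -/
theorem exists_bilin_of_isHomogeneous_two {G : MvPolynomial (Fin 4) k} (hG : G.IsHomogeneous 2) :
    ∃ B : (Fin 4 → k) →ₗ[k] (Fin 4 → k) →ₗ[k] k, ∀ v, MvPolynomial.eval v G = B v v := by
  rw [← MvPolynomial.mem_homogeneousSubmodule, ← MvPolynomial.homogeneousSubmodule_one_pow,
    pow_two] at hG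
  refine Submodule.mul_induction_on hG (fun m hm n hn => ?_) ?_
  · obtain ⟨f, hf, -⟩ := exists_linear_of_isHomogeneous_one hm
    obtain ⟨g, hg, -⟩ := exists_linear_of_isHomogeneous_one hn
    exact ⟨f.smulRight g, fun v => by simp [hf, hg]⟩
  · rintro x y ⟨f, hf⟩ ⟨g, hg⟩
    exact ⟨f + g, fun v => by simp [hf, hg]⟩

-- Segre coordinates and the two rulings of a quadric.

theorem Skew.ne_of_mem {L M : PLine k} (h : Skew L M) {p q : Pt k} (hp : p ∈ L.points)
    (hq : q ∈ M.points) : p ≠ q := fun hpq => Set.disjoint_left.1 h hp (hpq ▸ hq)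

theorem Skew.eq_zero {L M : PLine k} (h : Skew L M) {v : Fin 4 → k} (hL : v ∈ L.1)
    (hM : v ∈ M.1) : v = 0 := by
  by_contra h0
  exact Set.disjoint_left.1 h ((PLine.mk_mem_points h0).2 hL) ((PLine.mk_mem_points h0).2 hM)

/-- The representatives of `A ∩ B₁` and `A ∩ B₂` are rescaled so that their sum represents `A ∩ B₃`.
Doing this on two skew transversals gives a basis of `k ^ 4` in which the quadric has a
determinantal equation. -/
theorem exists_adapted_pair {A B₁ B₂ B₃ : PLine k} (h₁ : Meets A B₁) (h₂ : Meets A B₂)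
    (h₃ : Meets A B₃) (h₁₂ : Skew B₁ B₂) (h₁₃ : Skew B₁ B₃) (h₂₃ : Skew B₂ B₃) :
    ∃ a b, a ∈ A.1 ∧ a ∈ B₁.1 ∧ b ∈ A.1 ∧ b ∈ B₂.1 ∧ a + b ∈ B₃.1 ∧
      LinearIndependent k ![a, b] := by
  obtain ⟨p, hpA, hpB⟩ := h₁
  obtain ⟨q, hqA, hqB⟩ := h₂
  obtain ⟨r, hrA, hrB⟩ := h₃
  have hpq := h₁₂.ne_of_mem hpB hqB
  have hs := PLine.eq_span hpq hpA hqA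
  have hli := linearIndependent_rep hpq
  rw [PLine.mem_points] at *
  rw [hs, Submodule.mem_span_pair] at hrA
  obtain ⟨α, α', h⟩ := hrA
  have hα : α ≠ 0 := by
    rintro rfl
    rw [zero_smul, zero_add] at h
    exact r.rep_nonzero (h₂₃.eq_zero (h ▸ B₂.1.smul_mem α' hqB) hrB)
  have hα' : α' ≠ 0 := by
    rintro rfl
    rw [zero_smul, add_zero] at h
    exact r.rep_nonzero (h₁₃.eq_zero (h ▸ B₁.1.smul_mem α hpB) hrB)
  refine ⟨α • p.rep, α' • q.rep, A.1.smul_mem _ hpA, B₁.1.smul_mem _ hpB, A.1.smul_mem _ hqA,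
    B₂.1.smul_mem _ hqB, h ▸ hrB, ?_⟩
  rw [LinearIndependent.pair_iff] at hli ⊢
  intro s t hst
  rw [smul_smul, smul_smul] at hst
  obtain ⟨h1, h2⟩ := hli _ _ hst
  exact ⟨(mul_eq_zero.1 h1).resolve_right hα, (mul_eq_zero.1 h2).resolve_right hα'⟩

/-- `T` is a bilinear parametrization of the quadric `B v v = 0` by pairs of vectors of `k ^ 2`. -/
structure IsSegre (B : (Fin 4 → k) →ₗ[k] (Fin 4 → k) →ₗ[k] k)
    (T : (Fin 2 → k) →ₗ[k] (Fin 2 → k) →ₗ[k] (Fin 4 → k)) : Prop where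
  apply_eq_zero_iff : ∀ v, B v v = 0 ↔ ∃ x y, v = T x y
  eq_zero : ∀ x y, T x y = 0 → x = 0 ∨ y = 0
  left_parallel : ∀ x y x' y', T x y = T x' y' → T x y ≠ 0 → x 0 * x' 1 = x 1 * x' 0
  right_parallel : ∀ x y x' y', T x y = T x' y' → T x y ≠ 0 → y 0 * y' 1 = y 1 * y' 0
  parallel_or : ∀ x y x' y', B (T x y + T x' y') (T x y + T x' y') = 0 →
    x 0 * x' 1 = x 1 * x' 0 ∨ y 0 * y' 1 = y 1 * y' 0

theorem exists_eq_mul_of_det_eq_zero {a b c d : k} (h : a * d = b * c) :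
    ∃ x₀ x₁ y₀ y₁ : k, a = x₀ * y₀ ∧ b = x₀ * y₁ ∧ c = x₁ * y₀ ∧ d = x₁ * y₁ := by
  by_cases ha : a = 0
  · by_cases hb : b = 0
    · exact ⟨0, 1, c, d, by simp [ha, hb]⟩
    · have hc : c = 0 := by
        rw [ha, zero_mul, eq_comm, mul_eq_zero] at h
        exact h.resolve_left hb
      exact ⟨b, d, 0, 1, by simp [ha, hc]⟩
  · refine ⟨1, c / a, a, b, by simp, by simp, by field_simp, ?_⟩
    field_simp
    linear_combination h

theorem isSegre_of_basis {B : (Fin 4 → k) →ₗ[k] (Fin 4 → k) →ₗ[k] k}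
    (b : Module.Basis (Fin 2 × Fin 2) k (Fin 4 → k)) {c : k} (hc : c ≠ 0)
    (hB : ∀ v, B v v = c * (b.repr v (0, 0) * b.repr v (1, 1) - b.repr v (0, 1) * b.repr v (1, 0))) :
    ∃ T, IsSegre B T := by
  let T : (Fin 2 → k) →ₗ[k] (Fin 2 → k) →ₗ[k] (Fin 4 → k) :=
    LinearMap.mk₂ k (fun x y => ∑ i : Fin 2 × Fin 2, (x i.1 * y i.2) • b i)
      (fun x x' y => by simp [add_mul, add_smul, Finset.sum_add_distrib])
      (fun c x y => by simp [Finset.smul_sum, smul_smul, mul_assoc])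
      (fun x y y' => by simp [mul_add, add_smul, Finset.sum_add_distrib])
      (fun c x y => by simp [Finset.smul_sum, smul_smul, mul_left_comm])
  have hT : ∀ x y i j, b.repr (T x y) (i, j) = x i * y j := by
    intro x y i j
    change b.repr (∑ i : Fin 2 × Fin 2, (x i.1 * y i.2) • b i) (i, j) = _
    rw [b.repr_sum_self (fun i : Fin 2 × Fin 2 => x i.1 * y i.2)]
  refine ⟨T, ⟨fun v => ⟨fun h => ?_, ?_⟩, fun x y h => ?_, fun x y x' y' h h0 => ?_,
    fun x y x' y' h h0 => ?_, fun x y x' y' h => ?_⟩⟩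
  · rw [hB] at h
    obtain ⟨x₀, x₁, y₀, y₁, h1, h2, h3, h4⟩ := exists_eq_mul_of_det_eq_zero
      (sub_eq_zero.1 ((mul_eq_zero.1 h).resolve_left hc))
    refine ⟨![x₀, x₁], ![y₀, y₁], b.repr.injective (Finsupp.ext ?_)⟩
    rintro ⟨i, j⟩
    rw [hT]
    fin_cases i <;> fin_cases j <;> simp [h1, h2, h3, h4]
  · rintro ⟨x, y, rfl⟩
    rw [hB]
    simp only [hT]
    ring
  · have h1 : ∀ i j, x i * y j = 0 := fun i j => by rw [← hT, h]; simp
    by_contra! hne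
    obtain ⟨i, hi⟩ := Function.ne_iff.1 hne.1
    obtain ⟨j, hj⟩ := Function.ne_iff.1 hne.2
    exact mul_ne_zero hi hj (h1 i j)
  · have h1 : ∀ i j, x i * y j = x' i * y' j := fun i j => by rw [← hT, ← hT, h]
    have hy' : y' ≠ 0 := by
      rintro rfl
      exact h0 (by rw [h, map_zero])
    obtain ⟨j, hj⟩ := Function.ne_iff.1 hy'
    apply mul_right_cancel₀ hj
    linear_combination x 1 * h1 0 j - x 0 * h1 1 j
  · have h1 : ∀ i j, x i * y j = x' i * y' j := fun i j => by rw [← hT, ← hT, h]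
    have hx' : x' ≠ 0 := by
      rintro rfl
      exact h0 (by rw [h, map_zero, LinearMap.zero_apply])
    obtain ⟨j, hj⟩ := Function.ne_iff.1 hx'
    apply mul_right_cancel₀ hj
    linear_combination y 1 * h1 j 0 - y 0 * h1 j 1
  · rw [hB] at h
    have h1 := (mul_eq_zero.1 h).resolve_left hc
    simp only [map_add, Finsupp.add_apply, hT] at h1
    -- The quadratic form at `T x y + T x' y'` is `c` times the product of the determinants of `(x,
    -- x')` and `(y, y')`.
    have h2 : (x 0 * x' 1 - x 1 * x' 0) * (y 0 * y' 1 - y 1 * y' 0) = 0 := by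
      linear_combination h1
    rcases mul_eq_zero.1 h2 with h | h
    · exact Or.inl (sub_eq_zero.1 h)
    · exact Or.inr (sub_eq_zero.1 h)

theorem exists_isSegre {B : (Fin 4 → k) →ₗ[k] (Fin 4 → k) →ₗ[k] k} (hB : ∃ v, B v v ≠ 0)
    {A₁ A₂ B₁ B₂ B₃ : PLine k} (hA : Skew A₁ A₂) (h₁₂ : Skew B₁ B₂) (h₁₃ : Skew B₁ B₃)
    (h₂₃ : Skew B₂ B₃) (m₁₁ : Meets A₁ B₁) (m₁₂ : Meets A₁ B₂) (m₁₃ : Meets A₁ B₃)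
    (m₂₁ : Meets A₂ B₁) (m₂₂ : Meets A₂ B₂) (m₂₃ : Meets A₂ B₃)
    (hA₁ : A₁.points ⊆ formLocus B) (hA₂ : A₂.points ⊆ formLocus B)
    (hB₁ : B₁.points ⊆ formLocus B) (hB₂ : B₂.points ⊆ formLocus B)
    (hB₃ : B₃.points ⊆ formLocus B) : ∃ T, IsSegre B T := by
  obtain ⟨a₁, a₂, ha₁, hab₁, ha₂, hab₂, ha₃, ha⟩ := exists_adapted_pair m₁₁ m₁₂ m₁₃ h₁₂ h₁₃ h₂₃
  obtain ⟨b₁, b₂, hb₁, hbb₁, hb₂, hbb₂, hb₃, hb⟩ := exists_adapted_pair m₂₁ m₂₂ m₂₃ h₁₂ h₁₃ h₂₃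
  rw [LinearIndependent.pair_iff] at ha hb
  let w : Fin 2 × Fin 2 → Fin 4 → k := fun i => ![![a₁, a₂], ![b₁, b₂]] i.1 i.2
  have hw : LinearIndependent k w := by
    rw [Fintype.linearIndependent_iff]
    intro g hg
    simp only [Fintype.sum_prod_type, Fin.sum_univ_two, w] at hg
    simp only [Matrix.cons_val_zero, Matrix.cons_val_one] at hg
    have h1 : g (0, 0) • a₁ + g (0, 1) • a₂ = -(g (1, 0) • b₁ + g (1, 1) • b₂) :=
      eq_neg_of_add_eq_zero_left hg
    have h2 : g (0, 0) • a₁ + g (0, 1) • a₂ ∈ A₁.1 :=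
      A₁.1.add_mem (A₁.1.smul_mem _ ha₁) (A₁.1.smul_mem _ ha₂)
    have h3 : g (1, 0) • b₁ + g (1, 1) • b₂ ∈ A₂.1 :=
      A₂.1.add_mem (A₂.1.smul_mem _ hb₁) (A₂.1.smul_mem _ hb₂)
    have h4 := hA.eq_zero h2 (h1 ▸ A₂.1.neg_mem h3)
    have h5 : g (1, 0) • b₁ + g (1, 1) • b₂ = 0 := by rwa [h4, zero_add] at hg
    rintro ⟨i, j⟩
    fin_cases i <;> fin_cases j
    exacts [(ha _ _ h4).1, (ha _ _ h4).2, (hb _ _ h5).1, (hb _ _ h5).2]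
  let b := basisOfLinearIndependentOfCardEqFinrank hw (by simp)
  have hbw : ∀ i, b i = w i := fun i => by simp [b]
  have ea := fun x hx => apply_self_eq_zero hA₁ (u := x) hx
  have eb := fun x hx => apply_self_eq_zero hA₂ (u := x) hx
  have e1 := ea _ ha₁
  have e2 := ea _ ha₂
  have e3 := ea _ (A₁.1.add_mem ha₁ ha₂)
  have f1 := eb _ hb₁
  have f2 := eb _ hb₂
  have f3 := eb _ (A₂.1.add_mem hb₁ hb₂)
  have g1 := apply_self_eq_zero hB₁ (B₁.1.add_mem hab₁ hbb₁)
  have g2 := apply_self_eq_zero hB₂ (B₂.1.add_mem hab₂ hbb₂)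
  have g3 := apply_self_eq_zero hB₃ (B₃.1.add_mem ha₃ hb₃)
  simp only [map_add, LinearMap.add_apply] at e3 f3 g1 g2 g3
  -- Isotropy of the five lines kills every polar coefficient except those of `(a₁, b₂)` and `(a₂,
  -- b₁)`, and `B₃` makes these two opposite. Nonvanishing of the form then makes the constant
  -- nonzero.
  have key : ∀ v, B v v = (B a₁ b₂ + B b₂ a₁) *
      (b.repr v (0, 0) * b.repr v (1, 1) - b.repr v (0, 1) * b.repr v (1, 0)) := by
    intro v
    conv_lhs => rw [← b.sum_repr v]
    generalize b.repr v = r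
    simp only [Fintype.sum_prod_type, Fin.sum_univ_two, hbw, w, Matrix.cons_val_zero,
      Matrix.cons_val_one, map_add, map_smul, LinearMap.add_apply, LinearMap.smul_apply, smul_eq_mul]
    generalize r (0, 0) = s, r (0, 1) = t, r (1, 0) = u, r (1, 1) = v
    linear_combination s ^ 2 * e1 + t ^ 2 * e2 + s * t * (e3 - e1 - e2) + u ^ 2 * f1 + v ^ 2 * f2 +
      u * v * (f3 - f1 - f2) + s * u * (g1 - e1 - f1) + t * v * (g2 - e2 - f2) +
      t * u * (g3 - e3 - f3 - g1 + e1 + f1 - g2 + e2 + f2)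
  refine isSegre_of_basis b ?_ key
  obtain ⟨v, hv⟩ := hB
  intro h0
  exact hv (by rw [key, h0, zero_mul])

theorem eq_smul_of_parallel {x x' : Fin 2 → k} (h : x 0 * x' 1 = x 1 * x' 0) (hx : x ≠ 0) :
    ∃ c : k, x' = c • x := by
  by_cases h0 : x 0 = 0
  · have h1 : x 1 ≠ 0 := fun h1 => hx (by ext i; fin_cases i <;> assumption)
    refine ⟨x' 1 / x 1, ?_⟩
    rw [h0, zero_mul, eq_comm, mul_eq_zero] at h
    ext i
    fin_cases i
    · simp [h0, h.resolve_left h1]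
    · simp [h1]
  · refine ⟨x' 0 / x 0, ?_⟩
    ext i
    fin_cases i
    · simp [h0]
    · simp only [Fin.mk_one, Pi.smul_apply, smul_eq_mul]
      field_simp
      linear_combination h

/-- The lines `T x (k ^ 2)`. -/
def segreRuling (T : (Fin 2 → k) →ₗ[k] (Fin 2 → k) →ₗ[k] (Fin 4 → k)) : Set (PLine k) :=
  {L | ∃ x ≠ 0, L.1 = LinearMap.range (T x)}

namespace IsSegre

variable {B : (Fin 4 → k) →ₗ[k] (Fin 4 → k) →ₗ[k] k}
  {T : (Fin 2 → k) →ₗ[k] (Fin 2 → k) →ₗ[k] (Fin 4 → k)}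

theorem flip (h : IsSegre B T) : IsSegre B T.flip where
  apply_eq_zero_iff v := (h.apply_eq_zero_iff v).trans exists_comm
  eq_zero x y hxy := (h.eq_zero y x hxy).symm
  left_parallel x y x' y' := h.right_parallel y x y' x'
  right_parallel x y x' y' := h.left_parallel y x y' x'
  parallel_or x y x' y' hB := (h.parallel_or y x y' x' hB).symm

theorem finrank_range (h : IsSegre B T) {x : Fin 2 → k} (hx : x ≠ 0) :
    Module.finrank k (LinearMap.range (T x)) = 2 := by
  rw [LinearMap.finrank_range_of_inj, Module.finrank_fin_fun]
  rw [← LinearMap.ker_eq_bot, LinearMap.ker_eq_bot']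
  exact fun y hy => (h.eq_zero x y hy).resolve_left hx

theorem range_smul_le (c : k) (x : Fin 2 → k) :
    LinearMap.range (T (c • x)) ≤ LinearMap.range (T x) := by
  rintro _ ⟨y, rfl⟩
  exact ⟨c • y, by simp⟩

theorem subset (h : IsSegre B T) {L : PLine k} (hL : L ∈ segreRuling T) :
    L.points ⊆ formLocus B := by
  obtain ⟨x, -, hx⟩ := hL
  refine subset_formLocus fun u hu => ?_
  rw [hx] at hu
  obtain ⟨y, rfl⟩ := hu
  exact (h.apply_eq_zero_iff _).2 ⟨x, y, rfl⟩

theorem mem_of_parallel (h : IsSegre B T) {L : PLine k} {p q : Pt k} (hpq : p ≠ q)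
    (hp : p ∈ L.points) (hq : q ∈ L.points) {x y x' y' : Fin 2 → k} (hpx : p.rep = T x y)
    (hqx : q.rep = T x' y') (hxx : x 0 * x' 1 = x 1 * x' 0) : L ∈ segreRuling T := by
  have hx : x ≠ 0 := by
    rintro rfl
    exact p.rep_nonzero (by simp [hpx])
  obtain ⟨c, rfl⟩ := eq_smul_of_parallel hxx hx
  refine ⟨x, hx, Submodule.eq_of_le_of_finrank_eq ?_ (by rw [L.2, h.finrank_range hx])⟩
  rw [PLine.eq_span hpq hp hq, Submodule.span_le]
  rintro v (rfl | rfl)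
  · exact ⟨y, hpx.symm⟩
  · exact range_smul_le c x ⟨y', hqx.symm⟩

theorem subset_iff [Infinite k] (h : IsSegre B T) {L : PLine k} :
    L.points ⊆ formLocus B ↔ L ∈ segreRuling T ∨ L ∈ segreRuling T.flip := by
  refine ⟨fun hL => ?_, fun hL => hL.elim h.subset h.flip.subset⟩
  obtain ⟨p, hp, q, hq, hpq⟩ := L.infinite_points.nontrivial
  obtain ⟨x, y, hpx⟩ := (h.apply_eq_zero_iff _).1 (mem_formLocus.1 (hL hp))
  obtain ⟨x', y', hqx⟩ := (h.apply_eq_zero_iff _).1 (mem_formLocus.1 (hL hq))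
  have h1 := apply_self_eq_zero hL
    (L.1.add_mem (PLine.mem_points.1 hp) (PLine.mem_points.1 hq))
  rw [hpx, hqx] at h1
  rcases h.parallel_or _ _ _ _ h1 with h2 | h2
  · exact Or.inl (h.mem_of_parallel hpq hp hq hpx hqx h2)
  · exact Or.inr (h.flip.mem_of_parallel hpq hp hq hpx hqx h2)

theorem pairwise_skew (h : IsSegre B T) : (segreRuling T).Pairwise Skew := by
  rintro L ⟨x, hx, hL⟩ M ⟨x', hx', hM⟩ hLM
  rw [skew_iff_not_meets]
  rintro ⟨p, hpL, hpM⟩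
  rw [PLine.mem_points] at hpL hpM
  rw [hL] at hpL
  rw [hM] at hpM
  obtain ⟨y, hy⟩ := hpL
  obtain ⟨y', hy'⟩ := hpM
  obtain ⟨c, rfl⟩ := eq_smul_of_parallel
    (h.left_parallel x y x' y' (hy.trans hy'.symm) (hy ▸ p.rep_nonzero)) hx
  exact hLM (Subtype.ext (Submodule.eq_of_le_of_finrank_eq
    (hM ▸ hL ▸ range_smul_le c x) (by rw [L.2, M.2])).symm)

theorem meets (h : IsSegre B T) {L M : PLine k} (hL : L ∈ segreRuling T)
    (hM : M ∈ segreRuling T.flip) : Meets L M := by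
  obtain ⟨x, hx, hL⟩ := hL
  obtain ⟨y, hy, hM⟩ := hM
  have h0 : T x y ≠ 0 := fun h0 => (h.eq_zero x y h0).elim hx hy
  exact ⟨Projectivization.mk k _ h0, (PLine.mk_mem_points h0).2 (hL ▸ ⟨y, rfl⟩),
    (PLine.mk_mem_points h0).2 (hM ▸ ⟨x, rfl⟩)⟩

theorem disjoint (h : IsSegre B T) : Disjoint (segreRuling T) (segreRuling T.flip) := by
  rw [Set.disjoint_left]
  rintro L ⟨x, hx, hL⟩ ⟨y, hy, hL'⟩
  obtain ⟨x', hx', hne⟩ : ∃ x' : Fin 2 → k, x' ≠ 0 ∧ x 0 * x' 1 ≠ x 1 * x' 0 := by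
    by_cases h0 : x 0 = 0
    · refine ⟨![1, 0], fun h => by simpa using congrFun h 0, ?_⟩
      have h1 : x 1 ≠ 0 := fun h1 => hx (by ext i; fin_cases i <;> assumption)
      simpa using h1.symm
    · refine ⟨![0, 1], fun h => by simpa using congrFun h 1, ?_⟩
      simpa using h0
  have h1 : T x' y ∈ LinearMap.range (T x) := by
    rw [← hL, hL']
    exact ⟨x', rfl⟩
  obtain ⟨y', hy'⟩ := h1
  have h0 : T x' y ≠ 0 := fun h0 => (h.eq_zero x' y h0).elim hx' hy
  exact hne (h.left_parallel x y' x' y hy' (hy' ▸ h0))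

theorem covers (h : IsSegre B T) {p : Pt k} (hp : p ∈ formLocus B) :
    ∃ L ∈ segreRuling T, p ∈ L.points := by
  obtain ⟨x, y, hxy⟩ := (h.apply_eq_zero_iff _).1 (mem_formLocus.1 hp)
  have hx : x ≠ 0 := by
    rintro rfl
    exact p.rep_nonzero (by simp [hxy])
  exact ⟨⟨_, h.finrank_range hx⟩, ⟨x, hx, rfl⟩, PLine.mem_points.2 ⟨y, hxy.symm⟩⟩

end IsSegre

-- Lines meeting a quadric, and quadrics ruled compatibly with a configuration.

theorem subset_of_three_points {B : (Fin 4 → k) →ₗ[k] (Fin 4 → k) →ₗ[k] k} {L : PLine k}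
    {p q r : Pt k} (hpq : p ≠ q) (hpr : p ≠ r) (hqr : q ≠ r)
    (hp : p ∈ L.points ∩ formLocus B) (hq : q ∈ L.points ∩ formLocus B)
    (hr : r ∈ L.points ∩ formLocus B) : L.points ⊆ formLocus B := by
  have hs := PLine.eq_span hpq hp.1 hq.1
  have hpp := mem_formLocus.1 hp.2
  have hqq := mem_formLocus.1 hq.2
  have hrr := mem_formLocus.1 hr.2
  have hrs := PLine.mem_points.1 hr.1
  rw [hs, Submodule.mem_span_pair] at hrs
  obtain ⟨a, b, hab⟩ := hrs
  have hb : b ≠ 0 := by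
    rintro rfl
    rw [zero_smul, add_zero] at hab
    have h := (rep_pair_eq_zero hpr (a := a) (b := -1) (by simp [hab])).2
    exact one_ne_zero (neg_eq_zero.1 h)
  have ha : a ≠ 0 := by
    rintro rfl
    rw [zero_smul, zero_add] at hab
    have h := (rep_pair_eq_zero hqr (a := b) (b := -1) (by simp [hab])).2
    exact one_ne_zero (neg_eq_zero.1 h)
  rw [← hab] at hrr
  simp only [map_add, map_smul, LinearMap.add_apply, LinearMap.smul_apply, smul_eq_mul, hpp,
    hqq] at hrr
  -- With `p` and `q` isotropic, the form on `L` is `a * b` times this polar value; the third zero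
  -- has `a * b ≠ 0`.
  have key : B p.rep q.rep + B q.rep p.rep = 0 := by
    have : a * b * (B p.rep q.rep + B q.rep p.rep) = 0 := by linear_combination hrr
    exact (mul_eq_zero.1 this).resolve_left (mul_ne_zero ha hb)
  refine subset_formLocus fun v hv => ?_
  rw [hs, Submodule.mem_span_pair] at hv
  obtain ⟨c, d, rfl⟩ := hv
  simp only [map_add, map_smul, LinearMap.add_apply, LinearMap.smul_apply, smul_eq_mul, hpp, hqq]
  linear_combination c * d * key

theorem inter_formLocus_nonempty [IsAlgClosed k] (B : (Fin 4 → k) →ₗ[k] (Fin 4 → k) →ₗ[k] k)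
    (L : PLine k) : (L.points ∩ formLocus B).Nonempty := by
  have : Infinite k := IsAlgClosed.instInfinite
  obtain ⟨p, hp, q, hq, hpq⟩ := L.infinite_points.nontrivial
  by_cases hpp : B p.rep p.rep = 0
  · exact ⟨p, hp, mem_formLocus.2 hpp⟩
  obtain ⟨c, hc⟩ := IsAlgClosed.exists_root
    (Polynomial.C (B p.rep p.rep) * Polynomial.X ^ 2 +
      Polynomial.C (B p.rep q.rep + B q.rep p.rep) * Polynomial.X + Polynomial.C (B q.rep q.rep))
    (by rw [Polynomial.degree_quadratic hpp]; decide)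
  have hc' : B p.rep p.rep * c ^ 2 + (B p.rep q.rep + B q.rep p.rep) * c + B q.rep q.rep = 0 := by
    simpa [Polynomial.IsRoot] using hc
  have h0 : c • p.rep + q.rep ≠ 0 := fun h0 => by
    exact one_ne_zero (rep_pair_eq_zero hpq (a := c) (b := 1) (by simpa using h0)).2
  refine ⟨Projectivization.mk k _ h0, (PLine.mk_mem_points h0).2
    (L.1.add_mem (L.1.smul_mem c (PLine.mem_points.1 hp)) (PLine.mem_points.1 hq)), ?_⟩
  intro v hv
  rw [Projectivization.submodule_mk, Submodule.mem_span_singleton] at hv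
  obtain ⟨a, rfl⟩ := hv
  simp only [map_add, map_smul, LinearMap.add_apply, LinearMap.smul_apply, smul_eq_mul]
  linear_combination a ^ 2 * hc'

/-- A quadric `Q` with rulings `R` and `S`, whose intersection with `X` is the union of the lines of
`A ⊆ R` and `B ⊆ S`. -/
structure RuledConfiguration (X : Set (Pt k)) (d : ℕ) (Q : Set (Pt k))
    (R S A B : Set (PLine k)) : Prop where
  subset_iff : ∀ L : PLine k, L.points ⊆ Q ↔ L ∈ R ∨ L ∈ S
  skew_left : R.Pairwise Skew
  skew_right : S.Pairwise Skew
  meets : ∀ L ∈ R, ∀ M ∈ S, Meets L M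
  disjoint : Disjoint R S
  covers_left : ∀ p ∈ Q, ∃ L ∈ R, p ∈ L.points
  covers_right : ∀ p ∈ Q, ∃ L ∈ S, p ∈ L.points
  subset_left : A ⊆ R
  subset_right : B ⊆ S
  card_left : A.encard = d
  card_right : B.encard = d
  inter_eq : Q ∩ X = ⋃ L ∈ A ∪ B, L.points
  three_points : ∀ (L : PLine k) (p q r : Pt k), p ≠ q → p ≠ r → q ≠ r → p ∈ L.points ∩ Q →
    q ∈ L.points ∩ Q → r ∈ L.points ∩ Q → L.points ⊆ Q
  nonempty : ∀ L : PLine k, (L.points ∩ Q).Nonempty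

theorem exists_three_of_encard {α : Type*} {s : Set α} {d : ℕ} (hs : s.encard = d) (hd : 3 ≤ d) :
    ∃ a ∈ s, ∃ b ∈ s, ∃ c ∈ s, a ≠ b ∧ a ≠ c ∧ b ≠ c := by
  obtain ⟨t, hts, ht⟩ := Set.exists_subset_encard_eq (s := s) (k := 3) (by
    rw [hs]
    exact_mod_cast hd)
  obtain ⟨a, b, c, hab, hac, hbc, rfl⟩ := Set.encard_eq_three.1 ht
  exact ⟨a, hts (by simp), b, hts (by simp), c, hts (by simp), hab, hac, hbc⟩

theorem exists_ruledConfiguration [IsAlgClosed k] {X : Set (Pt k)} {d : ℕ} (hd : 3 ≤ d)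
    {G : (Fin 4 → k) →ₗ[k] (Fin 4 → k) →ₗ[k] k} (hG : ∃ v, G v v ≠ 0)
    (h : DefinesQuadricConfiguration X d (formLocus G)) :
    ∃ R S A B, RuledConfiguration X d (formLocus G) R S A B := by
  have : Infinite k := IsAlgClosed.instInfinite
  obtain ⟨C, ⟨-, -, A, B, rfl, hA, hB, hAs, hBs, hAB⟩, hQX⟩ := h
  have hQ : ∀ L ∈ A ∪ B, L.points ⊆ formLocus G := fun L hL p hp =>
    (hQX.symm.subset (Set.mem_iUnion₂.2 ⟨L, hL, hp⟩)).1
  obtain ⟨A₁, hA₁, A₂, hA₂, A₃, hA₃, hA₁₂, -, -⟩ := exists_three_of_encard hA hd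
  obtain ⟨B₁, hB₁, B₂, hB₂, B₃, hB₃, hB₁₂, hB₁₃, hB₂₃⟩ := exists_three_of_encard hB hd
  -- Replacing `T` by `T.flip` if necessary puts `A₁` in the first ruling; skewness and incidence
  -- then determine the ruling of every other configuration line.
  obtain ⟨T, hT, hTA⟩ : ∃ T, IsSegre G T ∧ A₁ ∈ segreRuling T := by
    obtain ⟨T, hT⟩ := exists_isSegre hG (hAs hA₁ hA₂ hA₁₂) (hBs hB₁ hB₂ hB₁₂)
      (hBs hB₁ hB₃ hB₁₃) (hBs hB₂ hB₃ hB₂₃) (hAB _ hA₁ _ hB₁) (hAB _ hA₁ _ hB₂)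
      (hAB _ hA₁ _ hB₃) (hAB _ hA₂ _ hB₁) (hAB _ hA₂ _ hB₂) (hAB _ hA₂ _ hB₃)
      (hQ _ (Or.inl hA₁)) (hQ _ (Or.inl hA₂)) (hQ _ (Or.inr hB₁)) (hQ _ (Or.inr hB₂))
      (hQ _ (Or.inr hB₃))
    exact (hT.subset_iff.1 (hQ _ (Or.inl hA₁))).elim (fun h => ⟨T, hT, h⟩)
      fun h => ⟨T.flip, hT.flip, h⟩
  refine ⟨segreRuling T, segreRuling T.flip, A, B,
    { subset_iff := fun L => hT.subset_iff
      skew_left := hT.pairwise_skew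
      skew_right := hT.flip.pairwise_skew
      meets := fun L hL M hM => hT.meets hL hM
      disjoint := hT.disjoint
      covers_left := fun p hp => hT.covers hp
      covers_right := fun p hp => hT.flip.covers hp
      subset_left := fun M hM => ?_
      subset_right := fun M hM => ?_
      card_left := hA
      card_right := hB
      inter_eq := hQX
      three_points := fun L p q r => subset_of_three_points
      nonempty := inter_formLocus_nonempty G }⟩
  · refine (hT.subset_iff.1 (hQ _ (Or.inl hM))).resolve_right fun h => ?_
    have hne : A₁ ≠ M := fun e => Set.disjoint_left.1 hT.disjoint hTA (e ▸ h)
    exact skew_iff_not_meets.1 (hAs hA₁ hM hne) (hT.meets hTA h)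
  · refine (hT.subset_iff.1 (hQ _ (Or.inr hM))).resolve_left fun h => ?_
    -- A line of `B` in the ruling of `A₁` must be `A₁` itself, since it meets `A₁`. Then `A₁` would
    -- be both skew to and incident with another line of `B`.
    have he : A₁ = M := by
      by_contra hne
      exact skew_iff_not_meets.1 (hT.pairwise_skew hTA h hne) (hAB _ hA₁ _ hM)
    subst he
    obtain ⟨N, hN, hne⟩ : ∃ N ∈ B, A₁ ≠ N := by
      by_cases h1 : A₁ = B₁
      · exact ⟨B₂, hB₂, h1 ▸ hB₁₂⟩
      · exact ⟨B₁, hB₁, h1⟩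
    exact skew_iff_not_meets.1 (hBs hM hN hne) (hAB _ hA₁ _ hN)

namespace RuledConfiguration

variable {X : Set (Pt k)} {d : ℕ} {Q Q' : Set (Pt k)} {R S A B R' S' A' B' : Set (PLine k)}

theorem symm (h : RuledConfiguration X d Q R S A B) : RuledConfiguration X d Q S R B A where
  subset_iff L := (h.subset_iff L).trans or_comm
  skew_left := h.skew_right
  skew_right := h.skew_left
  meets L hL M hM := (h.meets M hM L hL).symm
  disjoint := h.disjoint.symm
  covers_left := h.covers_right
  covers_right := h.covers_left
  subset_left := h.subset_right
  subset_right := h.subset_left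
  card_left := h.card_right
  card_right := h.card_left
  inter_eq := by rw [h.inter_eq, Set.union_comm]
  three_points := h.three_points
  nonempty := h.nonempty

theorem subset_of_left (h : RuledConfiguration X d Q R S A B) {L : PLine k} (hL : L ∈ R) :
    L.points ⊆ Q := (h.subset_iff L).2 (Or.inl hL)

theorem subset_of_right (h : RuledConfiguration X d Q R S A B) {L : PLine k} (hL : L ∈ S) :
    L.points ⊆ Q := (h.subset_iff L).2 (Or.inr hL)

theorem left_subset_surface (h : RuledConfiguration X d Q R S A B) {L : PLine k} (hL : L ∈ A) :
    L.points ⊆ X := fun _ hp =>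
  (h.inter_eq.symm.subset (Set.mem_iUnion₂.2 ⟨L, Or.inl hL, hp⟩)).2

theorem right_subset_surface (h : RuledConfiguration X d Q R S A B) {L : PLine k} (hL : L ∈ B) :
    L.points ⊆ X := h.symm.left_subset_surface hL

theorem eq_of_mem_left (h : RuledConfiguration X d Q R S A B) {L M : PLine k} (hL : L ∈ R)
    (hM : M ∈ R) {p : Pt k} (hpL : p ∈ L.points) (hpM : p ∈ M.points) : L = M := by
  by_contra hne
  exact Set.disjoint_left.1 (h.skew_left hL hM hne) hpL hpM

theorem eq_of_mem_right (h : RuledConfiguration X d Q R S A B) {L M : PLine k} (hL : L ∈ S)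
    (hM : M ∈ S) {p : Pt k} (hpL : p ∈ L.points) (hpM : p ∈ M.points) : L = M :=
  h.symm.eq_of_mem_left hL hM hpL hpM

theorem exists_points (h : RuledConfiguration X d Q R S A B) {L : PLine k} (hL : L ∈ R) :
    ∃ P ⊆ L.points ∩ X, P.encard = d := by
  obtain ⟨p₀, -⟩ := h.nonempty L
  have : Nonempty (Pt k) := ⟨p₀⟩
  choose! f hf using fun M (hM : M ∈ B) => h.meets L hL M (h.subset_right hM)
  refine ⟨f '' B, ?_, ?_⟩
  · rintro _ ⟨M, hM, rfl⟩
    exact ⟨(hf M hM).1, h.right_subset_surface hM (hf M hM).2⟩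
  · rw [Set.InjOn.encard_image, h.card_right]
    intro M hM N hN hMN
    exact h.eq_of_mem_right (h.subset_right hM) (h.subset_right hN) (hf M hM).2
      (hMN ▸ (hf N hN).2)

theorem exists_right_through (h : RuledConfiguration X d Q R S A B) {L : PLine k} (hL : L ∈ R)
    (hLX : ¬ L.points ⊆ X) {p : Pt k} (hp : p ∈ L.points) (hpX : p ∈ X) :
    ∃ M ∈ B, p ∈ M.points := by
  obtain ⟨N, hN | hN, hpN⟩ :=
    Set.mem_iUnion₂.1 (h.inter_eq.subset ⟨h.subset_of_left hL hp, hpX⟩)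
  · exact absurd (h.left_subset_surface hN)
      (h.eq_of_mem_left hL (h.subset_left hN) hp hpN ▸ hLX)
  · exact ⟨N, hN, hpN⟩

theorem linesIn_inter [Infinite k] (h : RuledConfiguration X d Q R S A B) :
    linesIn (Q ∩ X) = A ∪ B := by
  ext L
  change L.points ⊆ Q ∩ X ↔ _
  rw [h.inter_eq]
  refine ⟨PLine.mem_of_subset_iUnion ?_, fun hL => Set.subset_biUnion_of_mem hL⟩
  exact (Set.finite_of_encard_eq_coe h.card_left).union (Set.finite_of_encard_eq_coe h.card_right)

theorem isRuling_left (h : RuledConfiguration X d Q R S A B) : IsRuling Q R :=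
  ⟨fun _ => h.subset_of_left, h.skew_left, h.covers_left⟩

theorem inOppositeRulings (h : RuledConfiguration X d Q R S A B) {s t : Set (PLine k)}
    (hs : s ⊆ R) (ht : t ⊆ S) (hne : s.Nonempty) : InOppositeRulings Q s t := by
  refine ⟨R, S, h.isRuling_left, h.symm.isRuling_left, ?_, hs, ht⟩
  rintro rfl
  obtain ⟨L, hL⟩ := hne
  exact Set.disjoint_left.1 h.disjoint (hs hL) (hs hL)

-- Common lines of two quadrics as Hermitian chords, and their orthogonal lines.

section Sesquilinear

variable {σ : k →+* k} {β : (Fin 4 → k) →ₛₗ[σ] (Fin 4 → k) →ₗ[k] k}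

theorem isHermitianChord (hβ : ∀ v, β v = 0 → v = 0) (hσ : ∃ b, σ b ≠ b)
    (h : RuledConfiguration (formLocus β) d Q R S A B)
    (h' : RuledConfiguration (formLocus β) d Q' R' S' A' B')
    (hnone : ∀ L : PLine k, L.points ⊆ Q → L.points ⊆ Q' → ¬ L.points ⊆ formLocus β)
    {L : PLine k} (hL : L ∈ R) (hL' : L ∈ R') : IsHermitianChord β d L := by
  have hLX := hnone L (h.subset_of_left hL) (h'.subset_of_left hL')
  refine ⟨hLX, h.exists_points hL, fun p hp hpX => ?_⟩
  obtain ⟨M, hM, hpM⟩ := h.exists_right_through hL hLX hp hpX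
  obtain ⟨N, hN, hpN⟩ := h'.exists_right_through hL' hLX hp hpX
  have hMX := h.right_subset_surface hM
  refine isHermitianPoint_of_two_lines hβ hσ hMX (h'.right_subset_surface hN) ?_ hpM hpN
  rintro rfl
  exact hnone M (h.subset_of_right (h.subset_right hM)) (h'.subset_of_right (h'.subset_right hN))
    hMX

theorem perp_mem (hd : 3 ≤ d) (hβ : ∀ v, β v = 0 → v = 0) (hσ : ∃ b, σ b ≠ b)
    (h : RuledConfiguration (formLocus β) d Q R S A B) {L L' : PLine k} (hL : L ∈ R)
    (hLh : IsHermitianChord β d L) (hL' : L'.1 = perp β L.1) : L' ∈ R := by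
  have hskew := hLh.skew_perp (by omega) hL'
  have key : ∀ M ∈ B, ∃ q, q ∈ L'.points ∩ Q ∧ q ∈ M.points := by
    intro M hM
    obtain ⟨p, hpL, hpM⟩ := h.meets L hL M (h.subset_right hM)
    -- Both lines lie in the tangent plane at `p = L ∩ M`: `L'` by orthogonality to `L`, and `M` as
    -- a line on `X` through `p`.
    obtain ⟨q, hq, hqM⟩ : Meets L' M := by
      refine meets_of_le (finrank_ker_rep hβ p) ?_ (PLine.le_ker hσ (h.right_subset_surface hM) hpM)
      rw [hL']
      exact fun v hv => hv _ (PLine.mem_points.1 hpL)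
    exact ⟨q, ⟨hq, h.subset_of_right (h.subset_right hM) hqM⟩, hqM⟩
  obtain ⟨M₁, hM₁, M₂, hM₂, M₃, hM₃, h₁₂, h₁₃, h₂₃⟩ := exists_three_of_encard h.card_right hd
  obtain ⟨q₁, hq₁, hqM₁⟩ := key M₁ hM₁
  obtain ⟨q₂, hq₂, hqM₂⟩ := key M₂ hM₂
  obtain ⟨q₃, hq₃, hqM₃⟩ := key M₃ hM₃
  have hB := h.skew_right.mono h.subset_right
  refine ((h.subset_iff L').1 (h.three_points L' q₁ q₂ q₃ ((hB hM₁ hM₂ h₁₂).ne_of_mem hqM₁ hqM₂)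
    ((hB hM₁ hM₃ h₁₃).ne_of_mem hqM₁ hqM₃) ((hB hM₂ hM₃ h₂₃).ne_of_mem hqM₂ hqM₃)
    hq₁ hq₂ hq₃)).resolve_right fun hS => ?_
  exact skew_iff_not_meets.1 hskew (h.meets L hL L' hS)

end Sesquilinear

-- The intersection of the two quadrics.

theorem exists_right_common (hd : 3 ≤ d) (h : RuledConfiguration X d Q R S A B)
    (h' : RuledConfiguration X d Q' R' S' A' B') {L L' : PLine k} (hLL : L ≠ L')
    (hL : L ∈ R) (hL' : L' ∈ R) (hR : L ∈ R') (hR' : L' ∈ R') (hLX : ¬ L.points ⊆ X)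
    (hLX' : ¬ L'.points ⊆ X) : ∃ m ∈ S, m ∈ S' := by
  obtain ⟨N, hN, -⟩ := exists_three_of_encard h.card_left hd
  have hNX := h.left_subset_surface hN
  have hNR := h.subset_left hN
  -- `N` lies on `X`, so it differs from `L` and `L'` and is skew to both; `p` is therefore a third
  -- point of `m` on `Q'`, besides those on `L` and `L'`.
  obtain ⟨p, hpN, hpQ'⟩ := h'.nonempty N
  obtain ⟨m, hm, hpm⟩ := h.covers_right p (h.subset_of_left hNR hpN)
  obtain ⟨x, hxL, hxm⟩ := h.meets L hL m hm
  obtain ⟨y, hyL, hym⟩ := h.meets L' hL' m hm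
  have hxy := (h.skew_left hL hL' hLL).ne_of_mem hxL hyL
  have hpx : p ≠ x := (h.skew_left hNR hL fun e => hLX (e ▸ hNX)).ne_of_mem hpN hxL
  have hpy : p ≠ y := (h.skew_left hNR hL' fun e => hLX' (e ▸ hNX)).ne_of_mem hpN hyL
  have hmQ' := h'.three_points m p x y hpx hpy hxy ⟨hpm, hpQ'⟩
    ⟨hxm, h'.subset_of_left hR hxL⟩ ⟨hym, h'.subset_of_left hR' hyL⟩
  refine ⟨m, hm, ((h'.subset_iff m).1 hmQ').resolve_left fun hmR => ?_⟩
  have := h'.eq_of_mem_left hR hmR hxL hxm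
  exact Set.disjoint_left.1 h.disjoint hL (this ▸ hm)

theorem inter_eq_union (h : RuledConfiguration X d Q R S A B)
    (h' : RuledConfiguration X d Q' R' S' A' B') (hQQ : ¬ Q ⊆ Q') {L L' m m' : PLine k}
    (hLL : L ≠ L') (hmm : m ≠ m') (hL : L ∈ R) (hL' : L' ∈ R) (hm : m ∈ S) (hm' : m' ∈ S)
    (hLQ : L.points ⊆ Q') (hLQ' : L'.points ⊆ Q') (hmQ : m.points ⊆ Q') (hmQ' : m'.points ⊆ Q') :
    Q ∩ Q' = L.points ∪ m.points ∪ L'.points ∪ m'.points := by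
  apply Set.Subset.antisymm
  · rintro p ⟨hp, hp'⟩
    by_contra hne
    simp only [Set.mem_union, not_or] at hne
    obtain ⟨⟨⟨hpL, hpm⟩, hpL'⟩, hpm'⟩ := hne
    refine hQQ ?_
    obtain ⟨r, hr, hpr⟩ := h.covers_left p hp
    obtain ⟨x, hxr, hxm⟩ := h.meets r hr m hm
    obtain ⟨y, hyr, hym⟩ := h.meets r hr m' hm'
    -- A further point puts a third line `r` of `R` on `Q'`. Every line of `S` then meets `Q'` on
    -- `r`, `L` and `L'`, so all of `Q` lies on `Q'`.
    have hrQ' := h'.three_points r p x y (fun e => hpm (e ▸ hxm)) (fun e => hpm' (e ▸ hym))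
      ((h.skew_right hm hm' hmm).ne_of_mem hxm hym) ⟨hpr, hp'⟩ ⟨hxr, hmQ hxm⟩ ⟨hyr, hmQ' hym⟩
    intro q hq
    obtain ⟨s, hs, hqs⟩ := h.covers_right q hq
    obtain ⟨a, har, has⟩ := h.meets r hr s hs
    obtain ⟨b, hbL, hbs⟩ := h.meets L hL s hs
    obtain ⟨c, hcL, hcs⟩ := h.meets L' hL' s hs
    exact h'.three_points s a b c
      ((h.skew_left hr hL fun e => hpL (e ▸ hpr)).ne_of_mem har hbL)
      ((h.skew_left hr hL' fun e => hpL' (e ▸ hpr)).ne_of_mem har hcL)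
      ((h.skew_left hL hL' hLL).ne_of_mem hbL hcL)
      ⟨has, hrQ' har⟩ ⟨hbs, hLQ hbL⟩ ⟨hcs, hLQ' hcL⟩ hqs
  · exact Set.union_subset (Set.union_subset (Set.union_subset
      (Set.subset_inter (h.subset_of_left hL) hLQ) (Set.subset_inter (h.subset_of_right hm) hmQ))
      (Set.subset_inter (h.subset_of_left hL') hLQ'))
      (Set.subset_inter (h.subset_of_right hm') hmQ')

-- Incidences between the two configurations and the double `2d`.

theorem encard_meets (h : RuledConfiguration X d Q R S A B)
    (h' : RuledConfiguration X d Q' R' S' A' B')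
    (hnone : ∀ L : PLine k, L.points ⊆ Q → L.points ⊆ Q' → ¬ L.points ⊆ X)
    {L L' m m' : PLine k} (hLL : L ≠ L') (hL : L ∈ R) (hL' : L' ∈ R) (hR : L ∈ R') (hR' : L' ∈ R')
    (hm : m ∈ S) (hm' : m' ∈ S) (hS : m ∈ S') (hS' : m' ∈ S')
    (hQQ : Q ∩ Q' ⊆ L.points ∪ m.points ∪ L'.points ∪ m'.points) {M : PLine k} (hM : M ∈ B) :
    {N ∈ B' | Meets M N}.encard = 2 := by
  have hMS := h.subset_right hM
  have hMX := h.right_subset_surface hM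
  have hMQ := h.subset_of_right hMS
  obtain ⟨x, hxL, hxM⟩ := h.meets L hL M hMS
  obtain ⟨y, hyL, hyM⟩ := h.meets L' hL' M hMS
  have hxy := (h.skew_left hL hL' hLL).ne_of_mem hxL hyL
  obtain ⟨N₁, hN₁, hxN₁⟩ := h'.exists_right_through hR
    (hnone L (h.subset_of_left hL) (h'.subset_of_left hR)) hxL (hMX hxM)
  obtain ⟨N₂, hN₂, hyN₂⟩ := h'.exists_right_through hR'
    (hnone L' (h.subset_of_left hL') (h'.subset_of_left hR')) hyL (hMX hyM)
  have hne : N₁ ≠ N₂ := by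
    rintro rfl
    have := PLine.eq_of_mem hxy hxM hyM hxN₁ hyN₂
    exact hnone M hMQ (this ▸ h'.subset_of_right (h'.subset_right hN₁)) hMX
  have hunique : ∀ K ∈ R, ∀ w z, w ∈ K.points → w ∈ M.points → z ∈ K.points → z ∈ M.points →
      w = z := by
    intro K hK w z hwK hwM hzK hzM
    by_contra hwz
    exact Set.disjoint_left.1 h.disjoint hK (PLine.eq_of_mem hwz hwK hzK hwM hzM ▸ hMS)
  -- The lines of `B'` share a ruling of `Q'` with `m` and `m'`, so they can meet `M` only at its
  -- points on `L` and `L'`, which yields the count 2.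
  have hoff : ∀ n ∈ S, n ∈ S' → ∀ N ∈ B', ∀ z ∈ N.points, z ∉ n.points := by
    intro n hn hn' N hN z hzN hzn
    refine hnone n (h.subset_of_right hn) (h'.subset_of_right hn') ?_
    rw [h'.eq_of_mem_right hn' (h'.subset_right hN) hzn hzN]
    exact h'.right_subset_surface hN
  rw [← Set.encard_pair hne]
  congr 1
  ext N
  constructor
  · rintro ⟨hN, z, hzM, hzN⟩
    have hNS := h'.subset_right hN
    rcases hQQ ⟨hMQ hzM, h'.subset_of_right hNS hzN⟩ with ((hz | hz) | hz) | hz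
    · rw [hunique L hL z x hz hzM hxL hxM] at hzN
      exact Or.inl (h'.eq_of_mem_right hNS (h'.subset_right hN₁) hzN hxN₁)
    · exact absurd hz (hoff m hm hS N hN z hzN)
    · rw [hunique L' hL' z y hz hzM hyL hyM] at hzN
      exact Or.inr (h'.eq_of_mem_right hNS (h'.subset_right hN₂) hzN hyN₂)
    · exact absurd hz (hoff m' hm' hS' N hN z hzN)
  · rintro (rfl | rfl)
    · exact ⟨hN₁, x, hxM, hxN₁⟩
    · exact ⟨hN₂, y, hyM, hyN₂⟩

theorem skew_of_left_of_right (h : RuledConfiguration X d Q R S A B)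
    (h' : RuledConfiguration X d Q' R' S' A' B')
    (hnone : ∀ L : PLine k, L.points ⊆ Q → L.points ⊆ Q' → ¬ L.points ⊆ X)
    {L L' m m' : PLine k} (hL : L ∈ R) (hL' : L' ∈ R) (hR : L ∈ R') (hR' : L' ∈ R')
    (hm : m ∈ S) (hm' : m' ∈ S) (hS : m ∈ S') (hS' : m' ∈ S')
    (hQQ : Q ∩ Q' ⊆ L.points ∪ m.points ∪ L'.points ∪ m'.points) {M N : PLine k} (hM : M ∈ A)
    (hN : N ∈ B') : Skew M N := by
  rw [skew_iff_not_meets]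
  rintro ⟨z, hzM, hzN⟩
  have hMR := h.subset_left hM
  have hNS := h'.subset_right hN
  have hl : ∀ n ∈ R, n ∈ R' → z ∉ n.points := by
    intro n hn hn' hz
    refine hnone n (h.subset_of_left hn) (h'.subset_of_left hn') ?_
    rw [h.eq_of_mem_left hn hMR hz hzM]
    exact h.left_subset_surface hM
  have hr : ∀ n ∈ S, n ∈ S' → z ∉ n.points := by
    intro n hn hn' hz
    refine hnone n (h.subset_of_right hn) (h'.subset_of_right hn') ?_
    rw [h'.eq_of_mem_right hn' hNS hz hzN]
    exact h'.right_subset_surface hN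
  rcases hQQ ⟨h.subset_of_left hMR hzM, h'.subset_of_right hNS hzN⟩ with ((hz | hz) | hz) | hz
  exacts [hl L hL hR hz, hr m hm hS hz, hl L' hL' hR' hz, hr m' hm' hS' hz]

end RuledConfiguration

theorem encard_meets_union {d : ℕ} {L : PLine k} {P P' : Set (PLine k)} (hP : ∀ M ∈ P, Meets L M)
    (hcard : P.encard = d) (hcard' : {M ∈ P' | Meets L M}.encard = 2) (hd : Disjoint P P') :
    {M ∈ P ∪ P' | Meets L M}.encard = d + 2 := by
  have h : {M ∈ P ∪ P' | Meets L M} = P ∪ {M ∈ P' | Meets L M} := by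
    ext M
    constructor
    · rintro ⟨h | h, hM⟩
      exacts [Or.inl h, Or.inr ⟨h, hM⟩]
    · rintro (h | h)
      exacts [⟨Or.inl h, hP M h⟩, ⟨Or.inr h.1, h.2⟩]
  rw [h, Set.encard_union_eq (hd.mono_right (Set.sep_subset _ _)), hcard, hcard']

namespace RuledConfiguration

variable {X : Set (Pt k)} {d : ℕ} {Q Q' : Set (Pt k)} {R S A B R' S' A' B' : Set (PLine k)}

theorem exists_double [Infinite k] (h : RuledConfiguration X d Q R S A B)
    (h' : RuledConfiguration X d Q' R' S' A' B')
    (hnone : ∀ L : PLine k, L.points ⊆ Q → L.points ⊆ Q' → ¬ L.points ⊆ X)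
    {L L' m m' : PLine k} (hLL : L ≠ L') (hmm : m ≠ m') (hL : L ∈ R) (hL' : L' ∈ R) (hR : L ∈ R')
    (hR' : L' ∈ R') (hm : m ∈ S) (hm' : m' ∈ S) (hS : m ∈ S') (hS' : m' ∈ S')
    (hQQ : Q ∩ Q' ⊆ L.points ∪ m.points ∪ L'.points ∪ m'.points) :
    ∃ A₀ B₀ : Set (PLine k), A₀ ∪ B₀ = linesIn (Q ∩ X) ∪ linesIn (Q' ∩ X) ∧
      (A₀ ∪ B₀).encard = 4 * d ∧ Disjoint A₀ B₀ ∧ IsDouble2d d A₀ B₀ := by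
  have hnone' : ∀ L : PLine k, L.points ⊆ Q' → L.points ⊆ Q → ¬ L.points ⊆ X :=
    fun L h1 h2 => hnone L h2 h1
  have hQQ' : Q' ∩ Q ⊆ L.points ∪ m.points ∪ L'.points ∪ m'.points := Set.inter_comm Q Q' ▸ hQQ
  have hswap : L.points ∪ m.points ∪ L'.points ∪ m'.points =
      m.points ∪ L.points ∪ m'.points ∪ L'.points := by
    ext p
    simp only [Set.mem_union]
    tauto
  have hAQ : ∀ N ∈ A ∪ B, N.points ⊆ Q ∧ N.points ⊆ X := by
    rintro N (hN | hN)
    exacts [⟨h.subset_of_left (h.subset_left hN), h.left_subset_surface hN⟩,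
      ⟨h.subset_of_right (h.subset_right hN), h.right_subset_surface hN⟩]
  have hAQ' : ∀ N ∈ A' ∪ B', N.points ⊆ Q' := by
    rintro N (hN | hN)
    exacts [h'.subset_of_left (h'.subset_left hN), h'.subset_of_right (h'.subset_right hN)]
  have hdisj : Disjoint (A ∪ B) (A' ∪ B') := Set.disjoint_left.2 fun N hN hN' =>
    hnone N (hAQ N hN).1 (hAQ' N hN') (hAQ N hN).2
  rw [Set.disjoint_union_left, Set.disjoint_union_right, Set.disjoint_union_right] at hdisj
  obtain ⟨⟨hAA', hAB'⟩, hBA', hBB'⟩ := hdisj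
  have hAB : Disjoint A B := h.disjoint.mono h.subset_left h.subset_right
  have hAB'' : Disjoint A' B' := h'.disjoint.mono h'.subset_left h'.subset_right
  have hd : Disjoint (A ∪ B') (B ∪ A') := by
    rw [Set.disjoint_union_left, Set.disjoint_union_right, Set.disjoint_union_right]
    exact ⟨⟨hAB, hAA'⟩, hBB'.symm, hAB''.symm⟩
  have c₁ : (A ∪ B').encard = 2 * d := by
    rw [Set.encard_union_eq hAB', h.card_left, h'.card_right, two_mul]
  have c₂ : (B ∪ A').encard = 2 * d := by
    rw [Set.encard_union_eq hBA', h.card_right, h'.card_left, two_mul]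
  refine ⟨A ∪ B', B ∪ A', ?_, ?_, hd, c₁, c₂, ?_, ?_, ?_, ?_⟩
  · rw [h.linesIn_inter, h'.linesIn_inter]
    ext N
    simp only [Set.mem_union]
    tauto
  · rw [Set.encard_union_eq hd, c₁, c₂, ← add_mul]
    norm_num
  · rw [Set.pairwise_union]
    refine ⟨h.skew_left.mono h.subset_left, h'.skew_right.mono h'.subset_right,
      fun M hM N hN _ => ?_⟩
    have := h.skew_of_left_of_right h' hnone hL hL' hR hR' hm hm' hS hS' hQQ hM hN
    exact ⟨this, this.symm⟩
  · rw [Set.pairwise_union]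
    refine ⟨h.skew_right.mono h.subset_right, h'.skew_left.mono h'.subset_left,
      fun M hM N hN _ => ?_⟩
    have := h'.skew_of_left_of_right h hnone' hR hR' hL hL' hS hS' hm hm' hQQ' hN hM
    exact ⟨this.symm, this⟩
  -- All four counts come from `encard_meets`, after exchanging the two quadrics or the two rulings:
  -- `d` lines come from the opposite family on the same quadric, two from the other quadric.
  · rintro M (hM | hM)
    · exact encard_meets_union
        (fun N hN => h.meets M (h.subset_left hM) N (h.subset_right hN)) h.card_right
        (h.symm.encard_meets h'.symm hnone hmm hm hm' hS hS' hL hL' hR hR' (hswap ▸ hQQ) hM) hBA'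
    · rw [Set.union_comm]
      exact encard_meets_union
        (fun N hN => (h'.meets N (h'.subset_left hN) M (h'.subset_right hM)).symm) h'.card_left
        (h'.encard_meets h hnone' hLL hR hR' hL hL' hS hS' hm hm' hQQ' hM) hBA'.symm
  · rintro M (hM | hM)
    · exact encard_meets_union
        (fun N hN => (h.meets N (h.subset_left hN) M (h.subset_right hM)).symm) h.card_left
        (h.encard_meets h' hnone hLL hL hL' hR hR' hm hm' hS hS' hQQ hM) hAB'
    · rw [Set.union_comm]
      exact encard_meets_union
        (fun N hN => h'.meets M (h'.subset_left hM) N (h'.subset_right hN)) h'.card_right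
        (h'.symm.encard_meets h.symm hnone' hmm hS hS' hm hm' hR hR' hL hL' (hswap ▸ hQQ') hM)
        hAB'.symm

theorem double_and_inter [Infinite k] {σ : k →+* k} {β : (Fin 4 → k) →ₛₗ[σ] (Fin 4 → k) →ₗ[k] k} (hd : 3 ≤ d)
    (hβ : ∀ v, β v = 0 → v = 0) (hσ : Function.Surjective σ) (hσ' : ∃ b, σ b ≠ b)
    (h : RuledConfiguration (formLocus β) d Q R S A B)
    (h' : RuledConfiguration (formLocus β) d Q' R' S' A' B')
    (hnone : ∀ L : PLine k, L.points ⊆ Q → L.points ⊆ Q' → ¬ L.points ⊆ formLocus β)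
    {L : PLine k} (hL : L ∈ R) (hR : L ∈ R') :
    (∃ A₀ B₀ : Set (PLine k),
      A₀ ∪ B₀ = linesIn (Q ∩ formLocus β) ∪ linesIn (Q' ∩ formLocus β) ∧
      (A₀ ∪ B₀).encard = 4 * d ∧ Disjoint A₀ B₀ ∧ IsDouble2d d A₀ B₀) ∧
    (∃ l m l' m' : PLine k, [l, m, l', m'].Nodup ∧
      Q ∩ Q' = l.points ∪ m.points ∪ l'.points ∪ m'.points ∧
      IsDualPair (formLocus β) d l l' ∧ IsDualPair (formLocus β) d m m' ∧
      InOppositeRulings Q {l, l'} {m, m'} ∧ InOppositeRulings Q' {l, l'} {m, m'}) := by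
  have hd2 : 2 ≤ d := by omega
  have hne : ∀ {M N : PLine k}, Skew M N → M ≠ N := by
    rintro M _ hs rfl
    obtain ⟨p, hp⟩ := M.infinite_points.nonempty
    exact Set.disjoint_left.1 hs hp hp
  let L' : PLine k := ⟨perp β L.1, finrank_perp hβ hσ L⟩
  have hLh := h.isHermitianChord hβ hσ' h' hnone hL hR
  have hL' : L' ∈ R := h.perp_mem hd hβ hσ' hL hLh rfl
  have hR' : L' ∈ R' := h'.perp_mem hd hβ hσ' hR hLh rfl
  have hLh' := h.isHermitianChord hβ hσ' h' hnone hL' hR'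
  have hLL : L ≠ L' := hne (hLh.skew_perp hd2 rfl)
  obtain ⟨m, hm, hS⟩ := h.exists_right_common hd h' hLL hL hL' hR hR' hLh.not_subset hLh'.not_subset
  let m' : PLine k := ⟨perp β m.1, finrank_perp hβ hσ m⟩
  have hmh := h.symm.isHermitianChord hβ hσ' h'.symm hnone hm hS
  have hm' : m' ∈ S := h.symm.perp_mem hd hβ hσ' hm hmh rfl
  have hS' : m' ∈ S' := h'.symm.perp_mem hd hβ hσ' hS hmh rfl
  have hmh' := h.symm.isHermitianChord hβ hσ' h'.symm hnone hm' hS'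
  have hmm : m ≠ m' := hne (hmh.skew_perp hd2 rfl)
  -- Otherwise a line of `A` would lie on `Q`, `Q'` and `X` at once.
  have hQQ : ¬ Q ⊆ Q' := by
    intro hQ
    obtain ⟨N, hN, -⟩ := exists_three_of_encard h.card_left hd
    have hNQ := h.subset_of_left (h.subset_left hN)
    exact hnone N hNQ (hNQ.trans hQ) (h.left_subset_surface hN)
  have hinter := h.inter_eq_union h' hQQ hLL hmm hL hL' hm hm' (h'.subset_of_left hR)
    (h'.subset_of_left hR') (h'.subset_of_right hS) (h'.subset_of_right hS')
  have hRS : ∀ {M N : PLine k}, M ∈ R → N ∈ S → M ≠ N := by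
    rintro M _ hM hN rfl
    exact Set.disjoint_left.1 h.disjoint hM hN
  refine ⟨h.exists_double h' hnone hLL hmm hL hL' hR hR' hm hm' hS hS' hinter.subset,
    L, m, L', m', ?_, hinter, hLh.isDualPair hβ hσ hσ' hLh' hd2 rfl,
    hmh.isDualPair hβ hσ hσ' hmh' hd2 rfl,
    h.inOppositeRulings (Set.pair_subset hL hL') (Set.pair_subset hm hm') (by simp),
    h'.inOppositeRulings (Set.pair_subset hR hR') (Set.pair_subset hS hS') (by simp)⟩
  simp [hLL, hmm, hRS hL hm, hRS hL hm', (hRS hL' hm).symm, hRS hL' hm']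

end RuledConfiguration

-- From polynomials to forms.

theorem exists_sesquilinear {p : ℕ} [ExpChar k p] {e : ℕ} (hp : (p : k) = 0) (he : e ≠ 0)
    {F : MvPolynomial (Fin 4) k} (hF : IsFrobeniusForm (p ^ e) F) (hsmooth : IsSmoothSurface F) :
    ∃ β : (Fin 4 → k) →ₛₗ[iterateFrobenius k p e] (Fin 4 → k) →ₗ[k] k,
      zeroLocus F = formLocus β ∧ ∀ v, β v = 0 → v = 0 := by
  obtain ⟨l, hl, rfl⟩ := hF
  choose φ hφ hφ' using fun i => exists_linear_of_isHomogeneous_one (hl i)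
  let β : (Fin 4 → k) →ₛₗ[iterateFrobenius k p e] (Fin 4 → k) →ₗ[k] k :=
    { toFun := fun u => ∑ i, iterateFrobenius k p e (u i) • φ i
      map_add' := fun u v => by simp only [Pi.add_apply, map_add, add_smul, Finset.sum_add_distrib]
      map_smul' := fun c u => by
        simp only [Pi.smul_apply, smul_eq_mul, map_mul, Finset.smul_sum, smul_smul] }
  have hβ : ∀ u v, β u v = ∑ i, u i ^ p ^ e * φ i v := fun u v => by
    simp [β, iterateFrobenius_def]
  have hev : ∀ v, MvPolynomial.eval v (∑ i, MvPolynomial.X i ^ p ^ e * l i) = β v v := fun v => by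
    simp [hβ, hφ]
  refine ⟨β, ?_, fun v hv => ?_⟩
  · simp only [zeroLocus, formLocus, hev]
  · by_contra h0
    obtain ⟨i, hi⟩ := hsmooth v h0 (by rw [hev, hv, LinearMap.zero_apply])
    refine hi ?_
    -- The powers `X j ^ p ^ e` have zero derivative in characteristic `p`, so the `i`-th partial
    -- derivative at `v` is `β v` at the `i`-th basis vector.
    have h1 : β v (Pi.single i 1) = 0 := by rw [hv, LinearMap.zero_apply]
    rw [hβ] at h1
    rw [← h1, map_sum, map_sum]
    refine Finset.sum_congr rfl fun j _ => ?_
    simp [Derivation.leibniz_pow, hφ', hp, he]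

theorem exists_formLocus_eq [Infinite k] {G : MvPolynomial (Fin 4) k} (hG : IsQuadricForm G) :
    ∃ B : (Fin 4 → k) →ₗ[k] (Fin 4 → k) →ₗ[k] k, zeroLocus G = formLocus B ∧ ∃ v, B v v ≠ 0 := by
  obtain ⟨B, hB⟩ := exists_bilin_of_isHomogeneous_two hG.2
  refine ⟨B, by simp only [zeroLocus, formLocus, hB], ?_⟩
  by_contra! h
  exact hG.1 (MvPolynomial.funext fun v => by rw [hB, h, map_zero])

theorem exists_iterateFrobenius_ne [IsAlgClosed k] {p : ℕ} [ExpChar k p] {e : ℕ} (hq : 1 < p ^ e) :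
    ∃ b : k, iterateFrobenius k p e b ≠ b := by
  have : Infinite k := IsAlgClosed.instInfinite
  by_contra! h
  have hne : (Polynomial.X ^ p ^ e - Polynomial.X : Polynomial k) ≠ 0 :=
    FiniteField.X_pow_card_sub_X_ne_zero k hq
  refine hne (Polynomial.funext fun b => ?_)
  have := h b
  rw [iterateFrobenius_def] at this
  simp [this]

end ExtremalSurface

theorem mainTheorem12 {k : Type*} [Field k] [IsAlgClosed k] (p e d : ℕ) (hp : p.Prime)
    [CharP k p] (he : 0 < e) (hd : d = p ^ e + 1)
    (F : MvPolynomial (Fin 4) k) (hF : ExtremalSurface.IsFrobeniusForm (p ^ e) F)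
    (X : Set (ExtremalSurface.Pt k)) (hX : X = ExtremalSurface.zeroLocus F)
    (hsmooth : ExtremalSurface.IsSmoothSurface F)
    (G G' : MvPolynomial (Fin 4) k)
    (hG : ExtremalSurface.IsQuadricForm G) (hG' : ExtremalSurface.IsQuadricForm G')
    (Q Q' : Set (ExtremalSurface.Pt k))
    (hQ : Q = ExtremalSurface.zeroLocus G) (hQ' : Q' = ExtremalSurface.zeroLocus G')
    (hdist : Q ≠ Q')
    (hQX : ExtremalSurface.DefinesQuadricConfiguration X d Q)
    (hQX' : ExtremalSurface.DefinesQuadricConfiguration X d Q')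
    (hcommon : ∃ L : ExtremalSurface.PLine k, L.points ⊆ Q ∩ Q')
    (hnone : ¬ ∃ L : ExtremalSurface.PLine k, L.points ⊆ Q ∩ Q' ∧ L.points ⊆ X) :
    (∃ A B : Set (ExtremalSurface.PLine k),
      A ∪ B = ExtremalSurface.linesIn (Q ∩ X) ∪ ExtremalSurface.linesIn (Q' ∩ X) ∧
      (A ∪ B).encard = 4 * d ∧ Disjoint A B ∧
      ExtremalSurface.IsDouble2d d A B) ∧
    (∃ l m l' m' : ExtremalSurface.PLine k,
      [l, m, l', m'].Nodup ∧
      Q ∩ Q' = l.points ∪ m.points ∪ l'.points ∪ m'.points ∧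
      ExtremalSurface.IsDualPair X d l l' ∧
      ExtremalSurface.IsDualPair X d m m' ∧
      ExtremalSurface.InOppositeRulings Q {l, l'} {m, m'} ∧
      ExtremalSurface.InOppositeRulings Q' {l, l'} {m, m'}) := by
  have : Fact p.Prime := ⟨hp⟩
  have : Infinite k := IsAlgClosed.instInfinite
  have hq : 1 < p ^ e := Nat.one_lt_pow he.ne' hp.one_lt
  have hd3 : 3 ≤ d := by omega
  obtain ⟨β, hFβ, hβ⟩ := ExtremalSurface.exists_sesquilinear
    (CharP.cast_eq_zero k p) he.ne' hF hsmooth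
  obtain ⟨C, hGC, hC⟩ := ExtremalSurface.exists_formLocus_eq hG
  obtain ⟨C', hGC', hC'⟩ := ExtremalSurface.exists_formLocus_eq hG'
  rw [hFβ] at hX
  rw [hGC] at hQ
  rw [hGC'] at hQ'
  subst hX hQ hQ'
  obtain ⟨L, hL⟩ := hcommon
  have hnone' : ∀ L : ExtremalSurface.PLine k, L.points ⊆ ExtremalSurface.formLocus C →
      L.points ⊆ ExtremalSurface.formLocus C' → ¬ L.points ⊆ ExtremalSurface.formLocus β :=
    fun L h1 h2 h3 => hnone ⟨L, Set.subset_inter h1 h2, h3⟩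
  obtain ⟨R, S, A, B, h⟩ := ExtremalSurface.exists_ruledConfiguration hd3 hC hQX
  obtain ⟨R', S', A', B', h'⟩ := ExtremalSurface.exists_ruledConfiguration hd3 hC' hQX'
  have hσ : Function.Surjective (iterateFrobenius k p e) := (bijective_iterateFrobenius k p e).2
  have hσ' : ∃ b : k, iterateFrobenius k p e b ≠ b :=
    ExtremalSurface.exists_iterateFrobenius_ne hq
  -- Rulings are interchangeable through `symm`, so the common line may be placed in the first
  -- ruling of both quadrics.
  rcases (h.subset_iff L).1 (hL.trans Set.inter_subset_left) with hR | hS <;>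
    rcases (h'.subset_iff L).1 (hL.trans Set.inter_subset_right) with hR' | hS'
  · exact h.double_and_inter hd3 hβ hσ hσ' h' hnone' hR hR'
  · exact h.double_and_inter hd3 hβ hσ hσ' h'.symm hnone' hR hS'
  · exact h.symm.double_and_inter hd3 hβ hσ hσ' h' hnone' hS hR'
  · exact h.symm.double_and_inter hd3 hβ hσ hσ' h'.symm hnone' hS hS'
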